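/- Let $\mathbb C[t,t^{-1}]$ be the algebra of Laurent polynomials and let $L_W=\operatorname{Der}(\mathbb C[t,t^{-1}])$ be the Witt algebra, with basis $x_m=-t^{m+1}\frac{d}{dt}$ ($m\in\mathbb Z$). Let $L_V=L_W\oplus\mathbb C c$ be the Virasoro algebra: $c$ is central and $$[x_m,x_n]=(m-n)\,x_{m+n}+\delta_{m+n,0}\,\frac{m^3-m}{12}\,c .$$ For a field $F$ and $a\in M_n(F)$ put $\rho_n(a)=\frac1n\operatorname{rk}(a)$. A Lie algebra $L$ over $F$ is called (linearly) sofic if there are a non-principal ultrafilter $\omega$ on $\mathbb N$, a sequence of natural numbers $n_k\to\infty$, and an injective homomorphism of Lie algebras over $F$ $$L\hookrightarrow \Big(\prod_{k}M_{n_k}(F)\Big)\Big/\Big\{(a_k)_k:\ \lim_{k\to\omega}\rho_{n_k}(a_k)=0\Big\},$$ where the quotient algebra carries the commutator bracket. By a nontrivial one-dimensional central extension of a Lie algebra $Q$ we mean a surjective homomorphism of Lie algebras $p:L\to Q$ whose kernel is one-dimensional and central in $L$, and for which there is no Lie algebra homomorphism $s:Q\to L$ with $p\circ s=\mathrm{id}_Q$.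 Then the following hold. 1. The projection $\pi:L_V\to L_W$ with $\pi(c)=0$ is a nontrivial one-dimensional central extension of $L_W$. 2. It is the unique one: for every nontrivial one-dimensional central extension $p:L\to L_W$ there is an isomorphism of Lie algebras $e:L\to L_V$ with $\pi\circ e=p$. 3. The Virasoro algebra $L_V$ is sofic over $\mathbb C$. -/

import Mathlib

open Filter Topology
open scoped LaurentPolynomial

noncomputable section

/-! ### Metric ultraproducts of matrix algebras and soficity -/

namespace Sofic

variable (F : Type*) [Field F]

/-- The normalized rank `ρ_n(a) = rk(a) / n` of an `n × n` matrix. -/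
def normalizedRank {F : Type*} [Field F] {n : ℕ} (a : Matrix (Fin n) (Fin n) F) : ℝ :=
  (a.rank : ℝ) / (n : ℝ)

theorem normalizedRank_nonneg {F : Type*} [Field F] {n : ℕ} (a : Matrix (Fin n) (Fin n) F) :
    0 ≤ normalizedRank a := by
  unfold normalizedRank; positivity

theorem rank_add_le {F : Type*} [Field F] {n : ℕ} (a b : Matrix (Fin n) (Fin n) F) :
    (a + b).rank ≤ a.rank + b.rank := by
  unfold Matrix.rank
  rw [Matrix.mulVecLin_add]
  refine (Submodule.finrank_mono (LinearMap.range_add_le _ _)).trans ?_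
  exact Submodule.finrank_add_le_finrank_add_finrank _ _

/-- The ideal `ρ_ω⁻¹(0)` of `∏ₖ M_{n_k}(F)`: all sequences of matrices whose normalized ranks
tend to `0` along `ω`. -/
def rankKernel (ω : Ultrafilter ℕ) (n : ℕ → ℕ) :
    Ideal ((k : ℕ) → Matrix (Fin (n k)) (Fin (n k)) F) where
  carrier := {a | Tendsto (fun k => normalizedRank (a k)) ω (𝓝 0)}
  zero_mem' := by simp [normalizedRank]
  add_mem' := by
    intro a b ha hb
    have h := Tendsto.add ha hb
    rw [add_zero] at h
    refine squeeze_zero (fun k => normalizedRank_nonneg _) (fun k => ?_) h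
    simp only [normalizedRank, Pi.add_apply, ← add_div]
    gcongr
    exact_mod_cast rank_add_le (a k) (b k)
  smul_mem' := by
    intro c a ha
    refine squeeze_zero (fun k => normalizedRank_nonneg _) (fun k => ?_) ha
    simp only [normalizedRank, smul_eq_mul, Pi.mul_apply]
    gcongr
    exact Matrix.rank_mul_le_right (c k) (a k)

instance rankKernel_isTwoSided (ω : Ultrafilter ℕ) (n : ℕ → ℕ) :
    (rankKernel F ω n).IsTwoSided where
  mul_mem_of_left := by
    intro a b ha
    refine squeeze_zero (fun k => normalizedRank_nonneg _) (fun k => ?_) ha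
    simp only [normalizedRank, Pi.mul_apply]
    gcongr
    exact Matrix.rank_mul_le_left (a k) (b k)

/-- The metric ultraproduct `∏_{k → ω} M_{n_k}(F) / ker ρ_ω`. -/
abbrev Ultraproduct (ω : Ultrafilter ℕ) (n : ℕ → ℕ) : Type _ :=
  ((k : ℕ) → Matrix (Fin (n k)) (Fin (n k)) F) ⧸ rankKernel F ω n

/-- The universal sofic Lie algebra `∏_{k → ω} gl_{n_k}(F) / ker ρ_ω`: the metric ultraproduct
with the commutator bracket. -/
instance ultraproductLieRing (ω : Ultrafilter ℕ) (n : ℕ → ℕ) : LieRing (Ultraproduct F ω n) :=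
  LieRing.ofAssociativeRing

instance ultraproductLieAlgebra (ω : Ultrafilter ℕ) (n : ℕ → ℕ) :
    LieAlgebra F (Ultraproduct F ω n) :=
  LieAlgebra.ofAssociativeAlgebra

/-- A Lie algebra over `F` is (linearly) sofic if it embeds into the metric ultraproduct
`∏_{k → ω} gl_{n_k}(F) / ker ρ_ω` for some non-principal ultrafilter `ω` on `ℕ` and some sequence
of natural numbers `n_k → ∞`. -/
def IsSofic (L : Type*) [LieRing L] [LieAlgebra F L] : Prop :=
  ∃ (ω : Ultrafilter ℕ) (n : ℕ → ℕ), (∀ k : ℕ, ω ≠ pure k) ∧ Tendsto n atTop atTop ∧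
    ∃ Θ : L →ₗ⁅F⁆ Ultraproduct F ω n, Function.Injective Θ

end Sofic

/-! ### The Witt and Virasoro algebras -/

/-- The Witt algebra: the Lie algebra of derivations of `ℂ[t, t⁻¹]`. -/
abbrev Witt : Type := Derivation ℂ ℂ[T;T⁻¹] ℂ[T;T⁻¹]

namespace Virasoro

open LaurentPolynomial

/-- The bilinear form on `ℂ[t, t⁻¹]` with
`(∑ᵢ aᵢ tⁱ, ∑ⱼ bⱼ tʲ) ↦ ∑ₘ (m³ - m) / 12 * a_{m+1} * b_{-m+1}` (here `i = m + 1`). -/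
def form : ℂ[T;T⁻¹] →ₗ[ℂ] ℂ[T;T⁻¹] →ₗ[ℂ] ℂ :=
  LinearMap.mk₂ ℂ
    (fun f g => f.coeff.sum fun i a =>
      ((((i : ℂ) - 1) ^ 3 - ((i : ℂ) - 1)) / 12) * a * g.coeff (2 - i))
    (fun f f' g => by
      simp only [AddMonoidAlgebra.coeff_add]
      exact Finsupp.sum_add_index' (by simp) (by intros; ring))
    (fun c f g => by
      simp only [AddMonoidAlgebra.coeff_smul, smul_eq_mul]
      rw [Finsupp.sum_smul_index' (by simp), Finsupp.mul_sum]
      exact Finsupp.sum_congr fun _ _ => by simp only [smul_eq_mul]; ring)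
    (fun f g g' => by
      rw [← Finsupp.sum_add]
      exact Finsupp.sum_congr fun _ _ => by
        simp only [AddMonoidAlgebra.coeff_add, Finsupp.add_apply]; ring)
    (fun c f g => by
      rw [smul_eq_mul, Finsupp.mul_sum]
      exact Finsupp.sum_congr fun _ _ => by
        simp only [AddMonoidAlgebra.coeff_smul, Finsupp.smul_apply, smul_eq_mul]; ring)

theorem form_T (i j : ℤ) :
    form (T i) (T j) = if i + j = 2 then (((i : ℂ) - 1) ^ 3 - ((i : ℂ) - 1)) / 12 else 0 := by
  have h : form (T i) (T j) = ((((i : ℂ) - 1) ^ 3 - ((i : ℂ) - 1)) / 12) * 1 *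
      (T j : ℂ[T;T⁻¹]).coeff (2 - i) :=
    Finsupp.sum_single_index (a := i) (b := (1 : ℂ))
      (h := fun i a => ((((i : ℂ) - 1) ^ 3 - ((i : ℂ) - 1)) / 12) * a *
        (T j : ℂ[T;T⁻¹]).coeff (2 - i)) (by simp)
  rw [h, T_apply]
  by_cases hij : i + j = 2
  · rw [if_pos hij, if_pos (by lia)]; ring
  · rw [if_neg hij, if_neg (by lia)]; ring

/-- The derivative `f ↦ f'` of Laurent polynomials. -/
def deriv : ℂ[T;T⁻¹] →ₗ[ℂ] ℂ[T;T⁻¹] where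
  toFun f := f.coeff.sum fun i a => ((i : ℂ) * a) • T (i - 1)
  map_add' f g := by
    simp only [AddMonoidAlgebra.coeff_add]
    exact Finsupp.sum_add_index' (by simp) (by intros; rw [mul_add, add_smul])
  map_smul' c f := by
    simp only [AddMonoidAlgebra.coeff_smul, RingHom.id_apply]
    rw [Finsupp.sum_smul_index' (by simp), Finsupp.sum, Finsupp.sum, Finset.smul_sum]
    exact Finset.sum_congr rfl fun _ _ => by
      rw [smul_smul]; congr 1; simp only [smul_eq_mul]; ring

theorem deriv_T (i : ℤ) : deriv (T i) = (i : ℂ) • T (i - 1) := by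
  have h : deriv (T i) = ((i : ℂ) * 1) • (T (i - 1) : ℂ[T;T⁻¹]) :=
    Finsupp.sum_single_index (a := i) (b := (1 : ℂ))
      (h := fun i a => ((i : ℂ) * a) • (T (i - 1) : ℂ[T;T⁻¹])) (by simp)
  rw [h, mul_one]

theorem linearMap_ext {M : Type*} [AddCommMonoid M] [Module ℂ M] {u v : ℂ[T;T⁻¹] →ₗ[ℂ] M}
    (h : ∀ i : ℤ, u (T i) = v (T i)) : u = v := by
  refine LinearMap.ext fun f => ?_
  induction f using LaurentPolynomial.induction_on' with
  | add p q hp hq => rw [map_add, map_add, hp, hq]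
  | C_mul_T n a => rw [← smul_eq_C_mul, map_smul, map_smul, h]

/-- The derivation `d/dt` of `ℂ[t, t⁻¹]`. -/
def ddt : Witt :=
  Derivation.mk' deriv (by
    have h : LinearMap.compr₂ (LinearMap.mul ℂ ℂ[T;T⁻¹]) deriv =
        (LinearMap.mul ℂ ℂ[T;T⁻¹]).compl₂ deriv +
          ((LinearMap.mul ℂ ℂ[T;T⁻¹]).compl₂ deriv).flip := by
      refine linearMap_ext fun i => linearMap_ext fun j => ?_
      simp only [LinearMap.compr₂_apply, LinearMap.mul_apply', LinearMap.add_apply,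
        LinearMap.compl₂_apply, LinearMap.flip_apply, ← T_add, deriv_T, mul_smul_comm]
      rw [show i + (j - 1) = i + j - 1 by ring, show j + (i - 1) = i + j - 1 by ring, ← add_smul]
      congr 1
      push_cast
      ring
    intro f g
    exact LinearMap.congr_fun (LinearMap.congr_fun h f) g)

theorem ddt_T (i : ℤ) : ddt (T i) = (i : ℂ) • T (i - 1) := deriv_T i

theorem derivation_apply (D : Witt) (f : ℂ[T;T⁻¹]) : D f = D (T 1) * ddt f := by
  have hT (n : ℤ) : D (T n) = D (T 1) * ddt (T n) := by
    have step (i : ℤ) : D (T (i + 1)) - D (T 1) * ddt (T (i + 1)) =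
        T 1 * (D (T i) - D (T 1) * ddt (T i)) := by
      rw [T_add, D.leibniz, ddt.leibniz, ddt_T 1]
      simp only [smul_eq_mul, Int.cast_one, one_smul, sub_self, T_zero]
      ring
    induction n using Int.induction_on with
    | zero => simp
    | succ i hi => rw [← sub_eq_zero, step, hi, sub_self, mul_zero]
    | pred i hi =>
      have h := step (-(i : ℤ) - 1)
      rw [sub_add_cancel, hi, sub_self] at h
      rw [← sub_eq_zero]
      exact ((isUnit_T 1).mul_right_eq_zero).mp h.symm
  exact LinearMap.congr_fun (linearMap_ext (u := (D : ℂ[T;T⁻¹] →ₗ[ℂ] ℂ[T;T⁻¹]))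
    (v := (LinearMap.mul ℂ ℂ[T;T⁻¹] (D (T 1))).comp (ddt : ℂ[T;T⁻¹] →ₗ[ℂ] ℂ[T;T⁻¹])) hT) f

theorem lie_apply_T_one (D E : Witt) :
    ⁅D, E⁆ (T 1) = D (T 1) * ddt (E (T 1)) - E (T 1) * ddt (D (T 1)) := by
  rw [Derivation.commutator_apply, derivation_apply D, derivation_apply E (D (T 1))]

theorem form_skew (f g : ℂ[T;T⁻¹]) : form f g = - form g f := by
  have h : form = - form.flip := by
    refine linearMap_ext fun i => linearMap_ext fun j => ?_
    rw [LinearMap.neg_apply, LinearMap.neg_apply, LinearMap.flip_apply, form_T, form_T]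
    by_cases hij : i + j = 2
    · rw [if_pos hij, if_pos (by lia), show j = 2 - i by lia]
      push_cast
      ring
    · rw [if_neg hij, if_neg (by lia), neg_zero]
  exact LinearMap.congr_fun (LinearMap.congr_fun h f) g

theorem form_cocycle (f g h : ℂ[T;T⁻¹]) :
    form f (g * ddt h - h * ddt g) =
      form (f * ddt g - g * ddt f) h + form g (f * ddt h - h * ddt f) := by
  induction f using LaurentPolynomial.induction_on' with
  | add p q hp hq =>
    simp only [map_add, map_sub, add_mul, mul_add, LinearMap.add_apply, LinearMap.sub_apply]
      at hp hq ⊢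
    linear_combination hp + hq
  | C_mul_T i a =>
    induction g using LaurentPolynomial.induction_on' with
    | add p q hp hq =>
      simp only [map_add, map_sub, add_mul, mul_add, LinearMap.add_apply, LinearMap.sub_apply]
        at hp hq ⊢
      linear_combination hp + hq
    | C_mul_T j b =>
      induction h using LaurentPolynomial.induction_on' with
      | add p q hp hq =>
        simp only [map_add, map_sub, add_mul, mul_add, LinearMap.sub_apply]
          at hp hq ⊢
        linear_combination hp + hq
      | C_mul_T k c =>
        have key (i j : ℤ) : T i * ddt (T j) - T j * ddt (T i) =
            ((j : ℂ) - i) • (T (i + j - 1) : ℂ[T;T⁻¹]) := by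
          rw [ddt_T, ddt_T, mul_smul_comm, mul_smul_comm, ← T_add, ← T_add,
            show i + (j - 1) = i + j - 1 by ring, show j + (i - 1) = i + j - 1 by ring, sub_smul]
        have key' (i j : ℤ) (a b : ℂ) : (a • T i) * ddt (b • T j) - (b • T j) * ddt (a • T i) =
            (a * b * ((j : ℂ) - i)) • (T (i + j - 1) : ℂ[T;T⁻¹]) := by
          rw [mul_smul, ← key, Derivation.map_smul, Derivation.map_smul]
          simp only [smul_mul_assoc, mul_smul_comm, smul_smul, smul_sub]
          rw [mul_comm b a]
        rw [← smul_eq_C_mul, ← smul_eq_C_mul, ← smul_eq_C_mul, key', key', key']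
        simp only [map_smul, LinearMap.smul_apply, form_T, smul_eq_mul]
        by_cases hs : i + j + k = 3
        · rw [if_pos (by lia), if_pos (by lia), if_pos (by lia), show k = 3 - i - j by lia]
          push_cast
          ring
        · rw [if_neg (by lia), if_neg (by lia), if_neg (by lia)]
          ring

/-- The 2-cochain `(D, E) ↦ ∑ₘ (m³ - m) / 12 * a_{m+1} * b_{-m+1}` of the Witt algebra, where
`D = (∑ᵢ aᵢ tⁱ) d/dt` and `E = (∑ⱼ bⱼ tʲ) d/dt`. In terms of `x_m = -t^{m+1} d/dt` it is
`(x_m, x_n) ↦ (m³ - m) / 12` if `m + n = 0`, and `0` otherwise. -/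
def cochain : LieModule.Cohomology.twoCochain ℂ Witt (TrivialLieModule ℂ Witt ℂ) where
  val :=
    let ev : Witt →ₗ[ℂ] ℂ[T;T⁻¹] :=
      { toFun := fun D => D (T 1), map_add' := fun _ _ => rfl, map_smul' := fun _ _ => rfl }
    (form.compl₁₂ ev ev).compr₂ (TrivialLieModule.equiv ℂ Witt ℂ).symm.toLinearMap
  property := by
    intro D
    have h : form (D (T 1)) (D (T 1)) = 0 := by
      have := form_skew (D (T 1)) (D (T 1))
      linear_combination this / 2
    simpa using h

theorem cochain_apply (D E : Witt) :
    cochain D E = (TrivialLieModule.equiv ℂ Witt ℂ).symm (form (D (T 1)) (E (T 1))) := rfl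

/-- The Virasoro 2-cocycle of the Witt algebra with values in the trivial module `ℂ`. -/
def cocycle : LieModule.Cohomology.twoCocycle ℂ Witt (TrivialLieModule ℂ Witt ℂ) :=
  ⟨cochain, by
    rw [LieModule.Cohomology.mem_twoCocycle_iff_of_trivial]
    intro D E G
    simp only [cochain_apply, lie_apply_T_one, form_cocycle (D (T 1)), map_add]⟩

end Virasoro

/-- The Virasoro algebra: the central extension of the Witt algebra by `ℂ` given by the Virasoro
2-cocycle. It has the basis `x_m = -t^{m+1} d/dt` (`m ∈ ℤ`) and a central element `c`, and
`[x_m, x_n] = (m - n) x_{m+n} + δ_{m+n,0} (m³ - m) / 12 * c`. -/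
abbrev VirasoroAlgebra : Type := LieAlgebra.ofTwoCocycle Virasoro.cocycle

namespace Virasoro

/-- The projection of the Virasoro algebra onto the Witt algebra. -/
def proj : VirasoroAlgebra →ₗ⁅ℂ⁆ Witt where
  toFun x := ((LieAlgebra.ofProd cocycle).symm x).1
  map_add' _ _ := rfl
  map_smul' _ _ := rfl
  map_lie' := rfl

end Virasoro

/-- `p : L → Q` is a nontrivial one-dimensional central extension of `Q`: a surjective homomorphism
of Lie algebras with a one-dimensional central kernel that has no section which is a homomorphism of
Lie algebras. -/
structure IsNontrivialCentralExtension {K L Q : Type*} [Field K] [LieRing L] [LieAlgebra K L]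
    [LieRing Q] [LieAlgebra K Q] (p : L →ₗ⁅K⁆ Q) : Prop where
  surjective : Function.Surjective p
  finrank_ker : Module.finrank K p.ker = 1
  central : ∀ z x : L, p z = 0 → ⁅z, x⁆ = 0
  not_split : ¬ ∃ s : Q →ₗ⁅K⁆ L, ∀ x, p (s x) = x

end

noncomputable section

namespace Virasoro

open LaurentPolynomial LieAlgebra

/-! ### Homomorphisms out of the Virasoro algebra -/

/-! A homomorphism out of the Virasoro algebra amounts to a family `y m` and an element `w`
satisfying `Relations` (`liftHom`). This serves both uniqueness and soficity.

Nontriviality: a splitting would make the cocycle a coboundary, hence linear in `m` on the pairs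
`(m, -m)`, while `m ^ 3 - m` is not.

Uniqueness (`exists_relations`, `exists_equiv`): in a central extension brackets depend only on
images in the Witt algebra, so lifts of the generators can be normalized by brackets. The remaining
defect is central. The Jacobi identity with `y 0` confines it to degree zero, and the Jacobi
identity with `y 1` gives a recursion that forces it to be a multiple of `m ^ 3 - m`. If the
resulting `w` vanished, the extension would split.

Soficity: the Fock representation `Fock.vir` has central charge 1, so `c` acts as the identity. Each
operator shifts weight by a fixed amount, and the number of monomials of weight at most `N` grows
subexponentially. Hence there are weight balls with relatively small boundary, and compression to
them is multiplicative up to vanishing normalized rank. In the limit this gives a homomorphism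
sending `c` to `1`, which is nonzero in the ultraproduct. Every nonzero ideal contains `c`
(`central_mem_of_ne_zero`), so the kernel is zero. -/

theorem witt_ext {D E : Witt} (h : D (T 1) = E (T 1)) : D = E :=
  Derivation.ext fun f => by rw [derivation_apply D, derivation_apply E, h]

theorem smul_ddt_apply_T_one (f : ℂ[T;T⁻¹]) : (f • ddt : Witt) (T 1) = f := by
  rw [Derivation.smul_apply, ddt_T]
  simp

/-- The coordinate of `c` of an element of the Virasoro algebra. -/
def centralCoord : VirasoroAlgebra →ₗ[ℂ] ℂ where
  toFun v := TrivialLieModule.equiv ℂ Witt ℂ ((ofProd cocycle).symm v).2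
  map_add' _ _ := by simp
  map_smul' _ _ := by simp

/-- The Laurent polynomial `f` such that the Witt component of an element is `f d/dt`. -/
def symbol : VirasoroAlgebra →ₗ[ℂ] ℂ[T;T⁻¹] where
  toFun v := proj v (T 1)
  map_add' _ _ := by simp
  map_smul' _ _ := by simp

theorem symbol_apply (v : VirasoroAlgebra) : symbol v = proj v (T 1) := rfl

/-- The element `f d/dt + a c` of the Virasoro algebra. -/
def mk (f : ℂ[T;T⁻¹]) (a : ℂ) : VirasoroAlgebra :=
  ofProd cocycle (f • ddt, (TrivialLieModule.equiv ℂ Witt ℂ).symm a)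

@[simp]
theorem symbol_mk (f : ℂ[T;T⁻¹]) (a : ℂ) : symbol (mk f a) = f := smul_ddt_apply_T_one f

@[simp]
theorem centralCoord_mk (f : ℂ[T;T⁻¹]) (a : ℂ) : centralCoord (mk f a) = a := by
  simp [centralCoord, mk]

theorem vir_ext {u v : VirasoroAlgebra} (h : symbol u = symbol v)
    (h' : centralCoord u = centralCoord v) : u = v := by
  apply (ofProd cocycle).symm.injective
  refine Prod.ext (witt_ext h) ?_
  exact (TrivialLieModule.equiv ℂ Witt ℂ).injective h'

theorem symbol_lie (u v : VirasoroAlgebra) :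
    symbol ⁅u, v⁆ = symbol u * ddt (symbol v) - symbol v * ddt (symbol u) := by
  simp only [symbol_apply, LieHom.map_lie, lie_apply_T_one]

theorem centralCoord_lie (u v : VirasoroAlgebra) :
    centralCoord ⁅u, v⁆ = form (symbol u) (symbol v) := by
  have h : (ofProd cocycle).symm ⁅u, v⁆ = (⁅proj u, proj v⁆, cochain (proj u) (proj v)) := by
    rw [bracket_ofTwoCocycle]
    simp only [Equiv.symm_apply_apply, trivial_lie_zero, add_zero, sub_zero]
    rfl
  simp only [centralCoord, LinearMap.coe_mk, AddHom.coe_mk, h, cochain_apply,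
    LinearEquiv.apply_symm_apply, symbol_apply]

theorem proj_eq (v : VirasoroAlgebra) : proj v = symbol v • ddt :=
  witt_ext (by rw [smul_ddt_apply_T_one, symbol_apply])

section Lift

variable {M : Type*} [LieRing M] [LieAlgebra ℂ M]

/-- The linear map `∑ᵢ aᵢ tⁱ ↦ ∑ᵢ aᵢ yᵢ`. -/
def expand (y : ℤ → M) : ℂ[T;T⁻¹] →ₗ[ℂ] M where
  toFun f := f.coeff.sum fun i a => a • y i
  map_add' f g := by
    simp only [AddMonoidAlgebra.coeff_add]
    exact Finsupp.sum_add_index' (by simp) (by intros; rw [add_smul])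
  map_smul' c f := by
    simp only [AddMonoidAlgebra.coeff_smul, RingHom.id_apply]
    rw [Finsupp.sum_smul_index' (by simp), Finsupp.smul_sum]
    exact Finset.sum_congr rfl fun _ _ => smul_assoc _ _ _

theorem expand_T (y : ℤ → M) (i : ℤ) : expand y (T i) = y i := by
  have h : expand y (T i) = (1 : ℂ) • y i :=
    Finsupp.sum_single_index (a := i) (b := (1 : ℂ)) (h := fun i a => a • y i) (by simp)
  rw [h, one_smul]

/-- The Virasoro relations for a family `y` and a central element `w`. -/
structure Relations (y : ℤ → M) (w : M) : Prop where
  central : ∀ m, ⁅w, y m⁆ = 0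
  lie_eq : ∀ m n : ℤ, ⁅y m, y n⁆ = ((m : ℂ) - n) • y (m + n) +
    if m + n = 0 then (((m : ℂ) ^ 3 - m) / 12) • w else 0

variable {y : ℤ → M} {w : M}

/-- The linear map `f d/dt ↦ ∑ₘ -a_{m+1} y_m` for `f = ∑ᵢ aᵢ tⁱ`. -/
def expandSymbol (y : ℤ → M) : ℂ[T;T⁻¹] →ₗ[ℂ] M := expand fun i => -y (i - 1)

theorem expandSymbol_T (y : ℤ → M) (i : ℤ) : expandSymbol y (T i) = -y (i - 1) :=
  expand_T _ i

/-- Both sides are bilinear, so monomials suffice, where this is the relation on generators with the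
index shift `T i = -x_{i-1}`. -/
theorem Relations.lie_expandSymbol (h : Relations y w) (f g : ℂ[T;T⁻¹]) :
    ⁅expandSymbol y f, expandSymbol y g⁆ =
      expandSymbol y (f * ddt g - g * ddt f) + form f g • w := by
  induction f using LaurentPolynomial.induction_on' with
  | add p q hp hq =>
    have : (p + q) * ddt g - g * ddt (p + q) =
      (p * ddt g - g * ddt p) + (q * ddt g - g * ddt q) := by rw [map_add]; ring
    rw [this, map_add, add_lie, hp, hq, map_add, map_add, LinearMap.add_apply, add_smul]
    abel
  | C_mul_T i a =>
    induction g using LaurentPolynomial.induction_on' with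
    | add p q hp hq =>
      have : (C a * T i) * ddt (p + q) - (p + q) * ddt (C a * T i) =
        ((C a * T i) * ddt p - p * ddt (C a * T i)) +
          ((C a * T i) * ddt q - q * ddt (C a * T i)) := by rw [map_add]; ring
      rw [this, map_add, lie_add, hp, hq, map_add, map_add, add_smul]
      abel
    | C_mul_T j b =>
      have key : (a • T i) * ddt (b • T j) - (b • T j) * ddt (a • T i) =
          (a * b * ((j : ℂ) - i)) • (T (i + j - 1) : ℂ[T;T⁻¹]) := by
        rw [Derivation.map_smul, Derivation.map_smul, ddt_T, ddt_T]
        simp only [smul_mul_assoc, mul_smul_comm, ← T_add, smul_smul]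
        rw [show i + (j - 1) = i + j - 1 by ring, show j + (i - 1) = i + j - 1 by ring, ← sub_smul]
        congr 1
        ring
      rw [← smul_eq_C_mul, ← smul_eq_C_mul, key]
      simp only [map_smul, LinearMap.smul_apply, expandSymbol_T, smul_lie, lie_smul, neg_lie,
        lie_neg, h.lie_eq, form_T]
      rw [show i - 1 + (j - 1) = i + j - 1 - 1 by ring]
      by_cases hij : i + j = 2
      · rw [if_pos (by lia), if_pos hij]
        push_cast
        module
      · rw [if_neg (by lia), if_neg hij]
        push_cast
        module

theorem Relations.lie_central (h : Relations y w) (f : ℂ[T;T⁻¹]) : ⁅w, expandSymbol y f⁆ = 0 := by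
  induction f using LaurentPolynomial.induction_on' with
  | add p q hp hq => rw [map_add, lie_add, hp, hq, add_zero]
  | C_mul_T i a =>
    rw [← smul_eq_C_mul, map_smul, expandSymbol_T, lie_smul, lie_neg, h.central, neg_zero, smul_zero]

/-- The homomorphism from the Virasoro algebra given by a solution of the Virasoro relations. -/
def liftHom (h : Relations y w) : VirasoroAlgebra →ₗ⁅ℂ⁆ M where
  toLinearMap := (expandSymbol y).comp symbol + centralCoord.smulRight w
  map_lie' {u v} := by
    have h2 (f : ℂ[T;T⁻¹]) : ⁅expandSymbol y f, w⁆ = 0 := by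
      rw [← lie_skew, h.lie_central, neg_zero]
    simp [symbol_lie, centralCoord_lie, h.lie_expandSymbol, h.lie_central, h2]

theorem liftHom_apply (h : Relations y w) (v : VirasoroAlgebra) :
    liftHom h v = expandSymbol y (symbol v) + centralCoord v • w := rfl

end Lift

/-! ### The Virasoro algebra is a nontrivial central extension -/

theorem proj_eq_zero_iff {v : VirasoroAlgebra} : proj v = 0 ↔ symbol v = 0 :=
  ⟨fun h => by rw [symbol_apply, h]; rfl, fun h => by rw [proj_eq, h, zero_smul]⟩

theorem isNontrivialCentralExtension_proj : IsNontrivialCentralExtension proj where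
  surjective D := ⟨mk (D (T 1)) 0, by
    rw [proj_eq, symbol_mk]; exact witt_ext (smul_ddt_apply_T_one _)⟩
  finrank_ker := by
    refine finrank_eq_one (⟨mk 0 1, by rw [LieHom.mem_ker, proj_eq_zero_iff, symbol_mk]⟩ : proj.ker) ?_ ?_
    · intro h
      have := congrArg (fun v : proj.ker => centralCoord v.1) h
      simp at this
    · rintro ⟨v, hv⟩
      rw [LieHom.mem_ker, proj_eq_zero_iff] at hv
      refine ⟨centralCoord v, Subtype.ext (vir_ext ?_ ?_)⟩
      · simp [hv]
      · simp
  central z x hz := by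
    rw [proj_eq_zero_iff] at hz
    refine vir_ext ?_ ?_
    · simp [symbol_lie, hz]
    · simp [centralCoord_lie, hz]
  not_split := by
    rintro ⟨s, hs⟩
    have hsym (D : Witt) : symbol (s D) = D (T 1) := by rw [symbol_apply, hs]
    -- Compare central coordinates of `s` applied to the bracket of `t^i d/dt` and `t^{2-i} d/dt`, a
    -- multiple of `t d/dt`. The values `i = 0` and `i = -1` are already incompatible.
    have key (i : ℤ) : (((i : ℂ) - 1) ^ 3 - ((i : ℂ) - 1)) / 12 =
        (2 - 2 * (i : ℂ)) * centralCoord (s ((T 1 : ℂ[T;T⁻¹]) • ddt)) := by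
      have h1 := centralCoord_lie (s ((T i : ℂ[T;T⁻¹]) • ddt)) (s ((T (2 - i) : ℂ[T;T⁻¹]) • ddt))
      rw [hsym, hsym, smul_ddt_apply_T_one, smul_ddt_apply_T_one, form_T, if_pos (by ring),
        ← LieHom.map_lie] at h1
      have h2 : ⁅((T i : ℂ[T;T⁻¹]) • ddt : Witt), ((T (2 - i) : ℂ[T;T⁻¹]) • ddt : Witt)⁆ =
          (2 - 2 * (i : ℂ)) • ((T 1 : ℂ[T;T⁻¹]) • ddt : Witt) := by
        apply witt_ext
        rw [lie_apply_T_one, smul_ddt_apply_T_one, smul_ddt_apply_T_one, Derivation.smul_apply,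
          smul_ddt_apply_T_one, ddt_T, ddt_T, mul_smul_comm, mul_smul_comm, ← T_add, ← T_add,
          show i + (2 - i - 1) = 1 by ring, show 2 - i + (i - 1) = 1 by ring, ← sub_smul]
        congr 1
        push_cast
        ring
      rw [h2, map_smul, map_smul, smul_eq_mul] at h1
      exact h1.symm
    have k0 := key 0
    have k1 := key (-1)
    norm_num at k0 k1
    rw [k0] at k1
    norm_num at k1

end Virasoro

namespace Virasoro

open LaurentPolynomial LieAlgebra

/-! ### Uniqueness of the nontrivial central extension -/

/-- The element `x_m = -t^{m+1} d/dt` of the Witt algebra. -/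
def wittGen (m : ℤ) : Witt := (-T (m + 1) : ℂ[T;T⁻¹]) • ddt

theorem wittGen_lie (m n : ℤ) : ⁅wittGen m, wittGen n⁆ = ((m : ℂ) - n) • wittGen (m + n) := by
  apply witt_ext
  rw [lie_apply_T_one, Derivation.smul_apply, wittGen, wittGen, wittGen, smul_ddt_apply_T_one,
    smul_ddt_apply_T_one, smul_ddt_apply_T_one, map_neg, map_neg, ddt_T, ddt_T, neg_mul_neg,
    neg_mul_neg, mul_smul_comm, mul_smul_comm, ← T_add, ← T_add,
    show m + 1 + (n + 1 - 1) = m + n + 1 by ring, show n + 1 + (m + 1 - 1) = m + n + 1 by ring]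
  push_cast
  module

section Uniqueness

variable {L : Type*} [LieRing L] [LieAlgebra ℂ L] {p : L →ₗ⁅ℂ⁆ Witt}

theorem exists_relations (hsurj : Function.Surjective p) (hcent : ∀ z x : L, p z = 0 → ⁅z, x⁆ = 0) :
    ∃ (y : ℤ → L) (w : L), p w = 0 ∧ (∀ m, p (y m) = wittGen m) ∧ Relations y w := by
  choose u hu using fun m => hsurj (wittGen m)
  have hl {a b : L} (x : L) (h : p a = p b) : ⁅a, x⁆ = ⁅b, x⁆ := by
    rw [← sub_eq_zero, ← sub_lie]
    exact hcent _ _ (by rw [map_sub, h, sub_self])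
  have hr {a b : L} (x : L) (h : p a = p b) : ⁅x, a⁆ = ⁅x, b⁆ := by
    rw [← lie_skew, hl x h, lie_skew]
  -- Normalized so that `⁅y m, y 0⁆ = m • y m` and `⁅y 1, y (-1)⁆ = 2 • y 0` hold exactly, with no
  -- central correction.
  let y : ℤ → L := fun m => if m = 0 then (1 / 2 : ℂ) • ⁅u 1, u (-1)⁆ else (m : ℂ)⁻¹ • ⁅u m, u 0⁆
  have hy (m : ℤ) : p (y m) = wittGen m := by
    by_cases hm : m = 0
    · simp only [y, hm, if_pos, map_smul, LieHom.map_lie, hu, wittGen_lie, smul_smul]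
      norm_num
    · have : (m : ℂ) ≠ 0 := by exact_mod_cast hm
      simp only [y, hm, if_false, map_smul, LieHom.map_lie, hu, wittGen_lie, smul_smul]
      simp [this]
  have hyu (m n : ℤ) : ⁅y m, y n⁆ = ⁅u m, u n⁆ := by
    rw [hl (b := u m) _ (by rw [hy, hu]), hr (b := u n) _ (by rw [hy, hu])]
  have hy0 (m : ℤ) : ⁅y m, y 0⁆ = (m : ℂ) • y m := by
    by_cases hm : m = 0
    · simp [hm]
    · have : (m : ℂ) ≠ 0 := by exact_mod_cast hm
      rw [hyu]
      simp only [y, hm, if_false, smul_smul, mul_inv_cancel₀ this, one_smul]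
  have hy0' (m : ℤ) : ⁅y 0, y m⁆ = -((m : ℂ) • y m) := by rw [← lie_skew, hy0]
  have hy1 : ⁅y 1, y (-1)⁆ = (2 : ℂ) • y 0 := by
    rw [hyu]
    simp [y, smul_smul]
  let κ : ℤ → ℤ → L := fun m n => ⁅y m, y n⁆ - ((m : ℂ) - n) • y (m + n)
  have hκ (m n : ℤ) : p (κ m n) = 0 := by
    simp only [κ, map_sub, LieHom.map_lie, map_smul, hy, wittGen_lie, sub_self]
  have hlie (m n : ℤ) : ⁅y m, y n⁆ = ((m : ℂ) - n) • y (m + n) + κ m n := by simp [κ]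
  have hκl (m n : ℤ) (x : L) : ⁅κ m n, x⁆ = 0 := hcent _ _ (hκ m n)
  have hκr (m n : ℤ) (x : L) : ⁅x, κ m n⁆ = 0 := by rw [← lie_skew, hκl, neg_zero]
  -- The Jacobi identity with `y 0` says that the defect has weight `m + n` under a central action,
  -- so `(m + n) • κ m n = 0`.
  have hzero (m n : ℤ) (hmn : m + n ≠ 0) : κ m n = 0 := by
    have j := leibniz_lie (y 0) (y m) (y n)
    rw [hy0', hy0', hlie m n, lie_add, hκr, lie_smul, hy0', neg_lie, lie_neg, smul_lie, lie_smul,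
      hlie m n] at j
    have : ((m + n : ℤ) : ℂ) • κ m n = 0 := by
      push_cast at j ⊢
      linear_combination (norm := module) j
    exact (smul_eq_zero.mp this).resolve_left (by exact_mod_cast hmn)
  have hφ (m : ℤ) : ⁅y m, y (-m)⁆ = (2 * m : ℂ) • y 0 + κ m (-m) := by
    rw [hlie, add_neg_cancel]
    push_cast
    module
  have hrec (m : ℤ) : ((m : ℂ) - 1) • κ (m + 1) (-(m + 1)) = ((m : ℂ) + 2) • κ m (-m) := by
    have j := leibniz_lie (y 1) (y m) (y (-(m + 1)))
    rw [hlie m, hlie 1 m, hlie 1 (-(m + 1)), lie_add, lie_add, add_lie, hκr, hκr, hκl, lie_smul,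
      lie_smul, smul_lie, show m + -(m + 1) = -1 by ring, show 1 + -(m + 1) = -m by ring,
      add_comm 1 m, hy1, hφ, hφ] at j
    push_cast at j
    linear_combination (norm := module) j
  have hκ1 : κ 1 (-1) = 0 := by simp [κ, hy1]; module
  have hκ0 : κ 0 0 = 0 := by simp [κ]
  have hneg (m : ℤ) : κ (-m) m = -κ m (-m) := by
    simp only [κ, ← lie_skew (y m), add_neg_cancel, neg_add_cancel]
    push_cast
    module
  -- The factor 2 inverts `(2 ^ 3 - 2) / 12 = 1 / 2`.
  let w : L := (2 : ℂ) • κ 2 (-2)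
  have hnat (k : ℕ) : κ k (-k) = (((k : ℂ) ^ 3 - k) / 12) • w := by
    match k with
    | 0 => simpa using hκ0
    | 1 => simpa using hκ1
    -- The induction starts at 2: at `m = 1` the left side of `hrec` vanishes, so `κ 2 (-2)` is the
    -- free parameter.
    | k + 2 =>
      induction k with
      | zero =>
        simp only [w, smul_smul]
        norm_num
      | succ k ih =>
        have h1 : ((k : ℂ) + 1) ≠ 0 := by exact_mod_cast Nat.succ_ne_zero k
        have h2 := hrec (k + 2 : ℕ)
        rw [ih, smul_smul] at h2
        push_cast at h2 ⊢
        rw [show (k : ℂ) + 2 - 1 = k + 1 by ring] at h2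
        rw [show (k : ℤ) + 1 + 2 = k + 2 + 1 by ring, ← inv_smul_smul₀ h1 (κ _ _), h2, smul_smul]
        congr 1
        field_simp
        ring
  refine ⟨y, w, ?_, hy, ⟨fun m => ?_, fun m n => ?_⟩⟩
  · rw [map_smul, hκ, smul_zero]
  · rw [smul_lie, hκl, smul_zero]
  · rw [hlie]
    congr 1
    split_ifs with hmn
    · obtain rfl : n = -m := by lia
      obtain ⟨k, rfl | rfl⟩ := m.eq_nat_or_neg
      · exact_mod_cast hnat k
      · rw [neg_neg, hneg, hnat]
        push_cast
        module
    · exact hzero m n hmn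

theorem map_expandSymbol {y : ℤ → L} (hy : ∀ m, p (y m) = wittGen m) (f : ℂ[T;T⁻¹]) :
    p (expandSymbol y f) = f • ddt := by
  induction f using LaurentPolynomial.induction_on' with
  | add f g hf hg => rw [map_add, map_add, hf, hg, add_smul]
  | C_mul_T i a =>
    rw [← smul_eq_C_mul, map_smul, map_smul, expandSymbol_T, map_neg, hy, wittGen, sub_add_cancel]
    apply witt_ext
    rw [Derivation.smul_apply, Derivation.neg_apply, smul_ddt_apply_T_one, smul_ddt_apply_T_one,
      neg_neg]

/-- The map `liftHom h` covers the identity of the Witt algebra and carries `c` to `w`. Once `w ≠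
0`, it spans the one-dimensional kernel of `p`, so `liftHom h` is bijective. -/
theorem exists_equiv (hp : IsNontrivialCentralExtension p) :
    ∃ e : L ≃ₗ⁅ℂ⁆ VirasoroAlgebra, ∀ x, proj (e x) = p x := by
  obtain ⟨y, w, hw, hy, h⟩ := exists_relations hp.surjective hp.central
  have hw0 : w ≠ 0 := by
    -- With `w = 0` the lifts satisfy the Witt relations, and `expandSymbol y` is a section.
    rintro rfl
    let ev : Witt →ₗ[ℂ] ℂ[T;T⁻¹] :=
      { toFun := fun D => D (T 1), map_add' := fun _ _ => rfl, map_smul' := fun _ _ => rfl }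
    refine hp.not_split ⟨⟨(expandSymbol y).comp ev,
      fun {D E} => ?_⟩, fun D => ?_⟩
    · have := h.lie_expandSymbol (D (T 1)) (E (T 1))
      rw [smul_zero, add_zero, ← lie_apply_T_one] at this
      exact this.symm
    · exact (map_expandSymbol hy _).trans (witt_ext (smul_ddt_apply_T_one _))
  have hproj (v : VirasoroAlgebra) : p (liftHom h v) = proj v := by
    rw [liftHom_apply, map_add, map_smul, hw, smul_zero, add_zero, map_expandSymbol hy, proj_eq]
  have hinj : Function.Injective (liftHom h) := by
    rw [injective_iff_map_eq_zero]
    intro v hv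
    have h1 : symbol v = 0 := by rw [← proj_eq_zero_iff, ← hproj, hv, map_zero]
    rw [liftHom_apply, h1, map_zero, zero_add] at hv
    exact vir_ext (by rw [h1, map_zero])
      (by rw [(smul_eq_zero.mp hv).resolve_right hw0, map_zero])
  have hsurj : Function.Surjective (liftHom h) := by
    intro x
    have hx : p (x - expandSymbol y (p x (T 1))) = 0 := by
      rw [map_sub, map_expandSymbol hy, sub_eq_zero]
      exact witt_ext (smul_ddt_apply_T_one _).symm
    obtain ⟨a, ha⟩ := (finrank_eq_one_iff_of_nonzero' (⟨w, by rwa [LieHom.mem_ker]⟩ : p.ker)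
      (fun h => hw0 (congrArg Subtype.val h))).mp hp.finrank_ker ⟨_, by rwa [LieHom.mem_ker]⟩
    refine ⟨mk (p x (T 1)) a, ?_⟩
    have ha' : a • w = x - expandSymbol y (p x (T 1)) := congrArg Subtype.val ha
    rw [liftHom_apply, symbol_mk, centralCoord_mk, ha', add_sub_cancel]
  refine ⟨(LieEquiv.ofBijective (liftHom h) ⟨hinj, hsurj⟩).symm, fun x => ?_⟩
  rw [← hproj]
  congr 1
  exact (LieEquiv.ofBijective (liftHom h) ⟨hinj, hsurj⟩).apply_symm_apply x

end Uniqueness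

end Virasoro

/-! ### The bosonic Fock space -/

namespace Fock

open MvPolynomial

attribute [local instance] LieRing.ofAssociativeRing

/-- The bosonic Fock space `ℂ[X₀, X₁, …]`. -/
abbrev Space : Type := MvPolynomial ℕ ℂ

/-- The oscillators: `a_{-(k+1)}` multiplies by `X_k`, `a_{k+1} = (k+1) ∂/∂X_k`, and `a_0 = 0`. -/
def osc : ℤ → Module.End ℂ Space
  | .ofNat 0 => 0
  | .ofNat (k + 1) => ((k : ℂ) + 1) • (pderiv k : Derivation ℂ Space Space).toLinearMap
  | .negSucc k => LinearMap.mulLeft ℂ (X k)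

theorem osc_zero : osc 0 = 0 := rfl

theorem osc_pos (k : ℕ) :
    osc ((k : ℤ) + 1) = ((k : ℂ) + 1) • (pderiv k : Derivation ℂ Space Space).toLinearMap := rfl

theorem osc_neg (k : ℕ) : osc (-((k : ℤ) + 1)) = LinearMap.mulLeft ℂ (X k) := by
  rw [← Int.negSucc_eq]
  rfl

theorem int_cases (n : ℤ) : n = 0 ∨ (∃ k : ℕ, n = k + 1) ∨ ∃ k : ℕ, n = -(k + 1) := by
  rcases lt_trichotomy n 0 with h | h | h
  · exact Or.inr (Or.inr ⟨(-n - 1).toNat, by lia⟩)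
  · exact Or.inl h
  · exact Or.inr (Or.inl ⟨(n - 1).toNat, by lia⟩)

theorem commutator_smul_left (c : ℂ) (A B : Module.End ℂ Space) : ⁅c • A, B⁆ = c • ⁅A, B⁆ := by
  rw [Ring.lie_def, Ring.lie_def, smul_mul_assoc, mul_smul_comm, smul_sub]

theorem commutator_smul_right (c : ℂ) (A B : Module.End ℂ Space) : ⁅A, c • B⁆ = c • ⁅A, B⁆ := by
  rw [Ring.lie_def, Ring.lie_def, smul_mul_assoc, mul_smul_comm, smul_sub]

theorem lie_derivation_mulLeft (D : Derivation ℂ Space Space) (f : Space) :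
    ⁅(D : Module.End ℂ Space), LinearMap.mulLeft ℂ f⁆ = LinearMap.mulLeft ℂ (D f) := by
  refine LinearMap.ext fun g => ?_
  simp only [Ring.lie_def, LinearMap.sub_apply, Module.End.mul_apply, LinearMap.mulLeft_apply,
    Derivation.coeFn_coe, Derivation.leibniz, smul_eq_mul]
  ring

theorem lie_pderiv_pderiv (i j : ℕ) :
    ⁅((pderiv i : Derivation ℂ Space Space) : Module.End ℂ Space),
      ((pderiv j : Derivation ℂ Space Space) : Module.End ℂ Space)⁆ = 0 := by
  rw [← Derivation.commutator_coe_linear_map]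
  have : ⁅(pderiv i : Derivation ℂ Space Space),
      (pderiv j : Derivation ℂ Space Space)⁆ = 0 := by
    refine derivation_ext fun k => ?_
    rw [Derivation.commutator_apply, pderiv_X, pderiv_X]
    simp [Pi.single_apply, apply_ite]
  rw [this]
  rfl

theorem lie_pderiv_mulLeft (i j : ℕ) :
    ⁅((pderiv i : Derivation ℂ Space Space) : Module.End ℂ Space), LinearMap.mulLeft ℂ (X j : Space)⁆ =
      if i = j then 1 else 0 := by
  rw [lie_derivation_mulLeft, pderiv_X, Pi.single_apply]
  refine LinearMap.ext fun g => ?_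
  by_cases h : i = j
  · simp [h]
  · simp [h, Ne.symm h]

theorem osc_lie (m n : ℤ) : ⁅osc m, osc n⁆ = if m + n = 0 then (m : ℂ) • 1 else 0 := by
  rcases int_cases m with rfl | ⟨i, rfl⟩ | ⟨i, rfl⟩ <;>
    rcases int_cases n with rfl | ⟨j, rfl⟩ | ⟨j, rfl⟩
  · simp [osc_zero]
  · simp [osc_zero]
  · simp [osc_zero]
  · rw [osc_zero, lie_zero, if_neg (by lia)]
  · rw [if_neg (by lia), osc_pos, osc_pos, commutator_smul_left, commutator_smul_right, lie_pderiv_pderiv, smul_zero,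
      smul_zero]
  · rw [osc_pos, osc_neg, commutator_smul_left, lie_pderiv_mulLeft]
    by_cases h : i = j
    · rw [if_pos h, if_pos (by lia)]
      push_cast
      rfl
    · rw [if_neg h, if_neg (by lia), smul_zero]
  · rw [osc_zero, lie_zero, if_neg (by lia)]
  · rw [osc_pos, osc_neg, ← lie_skew, commutator_smul_left, lie_pderiv_mulLeft]
    by_cases h : i = j
    · rw [if_pos h.symm, if_pos (by lia), h]
      push_cast
      module
    · rw [if_neg (Ne.symm h), if_neg (by lia), smul_zero, neg_zero]
  · rw [if_neg (by lia), osc_neg, osc_neg, Ring.lie_def, sub_eq_zero]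
    refine LinearMap.ext fun g => ?_
    simp only [Module.End.mul_apply, LinearMap.mulLeft_apply]
    ring

theorem osc_one_of_nonneg {j : ℤ} (hj : 0 ≤ j) : osc j 1 = 0 := by
  rcases int_cases j with rfl | ⟨i, rfl⟩ | ⟨i, rfl⟩
  · simp [osc_zero]
  · simp [osc_pos]
  · lia

theorem osc_neg_one (k : ℕ) : osc (-((k : ℤ) + 1)) 1 = X k := by
  rw [osc_neg, LinearMap.mulLeft_apply, mul_one]

theorem pderiv_osc_one (k : ℕ) (j : ℤ) :
    pderiv k (osc j 1) = if j = -(k + 1) then 1 else 0 := by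
  rcases int_cases j with rfl | ⟨i, rfl⟩ | ⟨i, rfl⟩
  · rw [osc_one_of_nonneg le_rfl, if_neg (by lia), map_zero]
  · rw [osc_one_of_nonneg (by lia), if_neg (by lia), map_zero]
  · rw [osc_neg_one, pderiv_X, Pi.single_apply]
    by_cases h : i = k
    · rw [if_pos h, if_pos (by lia)]
    · rw [if_neg h, if_neg (by lia)]

theorem constantCoeff_osc {j : ℤ} (hj : j < 0) (f : Space) : constantCoeff (osc j f) = 0 := by
  obtain ⟨k, rfl⟩ : ∃ k : ℕ, j = -(k + 1) := ⟨(-j - 1).toNat, by lia⟩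
  simp only [osc_neg, LinearMap.mulLeft_apply, map_mul, constantCoeff_X, zero_mul]

/-- The derivation `X_k ↦ (k + 1) a_{m-k-1} 1` of the Fock space. -/
def shift (m : ℤ) : Derivation ℂ Space Space :=
  mkDerivation ℂ fun k => ((k : ℂ) + 1) • osc (m - k - 1) 1

theorem shift_X (m : ℤ) (k : ℕ) : shift m (X k) = ((k : ℂ) + 1) • osc (m - k - 1) 1 :=
  mkDerivation_X _ _ _

/-- `shift m` is the mixed-sign part of the normally ordered sum `½ ∑ :a_i a_{m-i}:`; as a
derivation it needs no convergence argument. In the exceptional range, `quad m` supplies the missing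
commutator. -/
theorem shift_lie_osc (m n : ℤ) : ⁅(shift m).toLinearMap, osc n⁆ =
    if -n ∈ Finset.Ioo (min 0 m) (max 0 m) then 0 else (-n : ℂ) • osc (m + n) := by
  simp only [Finset.mem_Ioo]
  rcases int_cases n with rfl | ⟨k, rfl⟩ | ⟨k, rfl⟩
  · simp [osc_zero]
  · rw [osc_pos, commutator_smul_right, ← Derivation.commutator_coe_linear_map]
    have hX (l : ℕ) : ⁅shift m, (pderiv k : Derivation ℂ Space Space)⁆ (X l) =
        if m - l - 1 = -(k + 1) then -((l : ℂ) + 1) • 1 else 0 := by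
      rw [Derivation.commutator_apply, pderiv_X, shift_X, Derivation.map_smul, pderiv_osc_one]
      have : shift m ((Pi.single k 1 : ℕ → Space) l) = 0 := by
        rw [Pi.single_apply, apply_ite (shift m)]
        simp
      rw [this, zero_sub]
      split_ifs
      · rw [neg_smul]
      · rw [smul_zero, neg_zero]
    by_cases hm : 0 ≤ m + k
    · obtain ⟨r, hr⟩ := Int.eq_ofNat_of_zero_le hm
      rw [if_neg (by lia), show m + ((k : ℤ) + 1) = r + 1 by lia, osc_pos]
      have : ⁅shift m, (pderiv k : Derivation ℂ Space Space)⁆ = -((r : ℂ) + 1) • pderiv r := by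
        refine derivation_ext fun l => ?_
        rw [hX, Derivation.smul_apply, pderiv_X, Pi.single_apply]
        by_cases hl : l = r
        · rw [if_pos (by lia), if_pos hl, hl]
        · rw [if_neg (by lia), if_neg hl, smul_zero]
      rw [this, Derivation.coe_smul_linearMap]
      push_cast
      module
    · have : ⁅shift m, (pderiv k : Derivation ℂ Space Space)⁆ = 0 := by
        refine derivation_ext fun l => ?_
        rw [hX, if_neg (by lia), Derivation.zero_apply]
      rw [this]
      split_ifs with h
      · exact smul_zero _
      · rw [show m + ((k : ℤ) + 1) = 0 by lia, osc_zero]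
        simp
  · rw [osc_neg, lie_derivation_mulLeft, shift_X]
    rcases int_cases (m + -((k : ℤ) + 1)) with h | ⟨r, h⟩ | ⟨r, h⟩
    · rw [osc_one_of_nonneg (by lia), h, osc_zero]
      simp
    · rw [osc_one_of_nonneg (by lia), if_pos (by lia)]
      simp
    · rw [if_neg (by lia), h, show m - k - 1 = -((r : ℤ) + 1) by lia, osc_neg_one, osc_neg]
      refine LinearMap.ext fun g => ?_
      simp

/-- The part of the Virasoro operator that consists of products of oscillators of one sign. -/
def quad (m : ℤ) : Module.End ℂ Space :=
  (1 / 2 : ℂ) • ∑ i ∈ Finset.Ioo (min 0 m) (max 0 m), osc i * osc (m - i)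

theorem quad_lie_osc (m n : ℤ) : ⁅quad m, osc n⁆ =
    if -n ∈ Finset.Ioo (min 0 m) (max 0 m) then (-n : ℂ) • osc (m + n) else 0 := by
  have key (i : ℤ) : ⁅osc i * osc (m - i), osc n⁆ =
      (if m + n = i then (-n : ℂ) • osc (m + n) else 0) +
        (if -n = i then (-n : ℂ) • osc (m + n) else 0) := by
    have : ⁅osc i * osc (m - i), osc n⁆ = osc i * ⁅osc (m - i), osc n⁆ +
        ⁅osc i, osc n⁆ * osc (m - i) := by
      simp only [Ring.lie_def, mul_sub, sub_mul, mul_assoc]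
      abel
    rw [this, osc_lie, osc_lie]
    congr 1
    · by_cases h : m + n = i
      · rw [if_pos h, if_pos (by lia), mul_smul_comm, mul_one, ← h]
        congr 1
        push_cast
        ring
      · rw [if_neg h, if_neg (by lia), mul_zero]
    · by_cases h : -n = i
      · rw [if_pos h, if_pos (by lia), smul_mul_assoc, one_mul, ← h, sub_neg_eq_add]
        push_cast
        rfl
      · rw [if_neg h, if_neg (by lia), zero_mul]
  rw [quad, commutator_smul_left, LieRing.of_associative_ring_bracket, Finset.sum_mul, Finset.mul_sum,
    ← Finset.sum_sub_distrib]
  simp only [← LieRing.of_associative_ring_bracket, key]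
  rw [Finset.sum_add_distrib, Finset.sum_ite_eq, Finset.sum_ite_eq]
  -- The range is stable under `i ↦ m - i`, so `i = m + n` and `i = -n` occur together, and their
  -- equal contributions cancel the factor `1 / 2`.
  by_cases h : -n ∈ Finset.Ioo (min 0 m) (max 0 m)
  · have h' : m + n ∈ Finset.Ioo (min 0 m) (max 0 m) := by
      rw [Finset.mem_Ioo] at h ⊢
      lia
    rw [if_pos h, if_pos h']
    module
  · have h' : m + n ∉ Finset.Ioo (min 0 m) (max 0 m) := by
      rw [Finset.mem_Ioo] at h ⊢
      lia
    rw [if_neg h, if_neg h', add_zero, smul_zero]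

/-- The Virasoro operators on the Fock space. -/
def vir (m : ℤ) : Module.End ℂ Space := (shift m).toLinearMap + quad m

theorem vir_lie_osc (m n : ℤ) : ⁅vir m, osc n⁆ = (-n : ℂ) • osc (m + n) := by
  rw [vir, add_lie, shift_lie_osc, quad_lie_osc]
  split_ifs <;> simp

/-! ### The commutant of the oscillators and the central charge -/

theorem eq_C_of_pderiv_eq_zero {f : Space} (h : ∀ k, pderiv k f = 0) : f = C (constantCoeff f) := by
  ext σ
  rw [coeff_C]
  split_ifs with hσ
  · rw [← hσ]
    rfl
  · obtain ⟨k, hk⟩ := Finsupp.ne_iff.mp (Ne.symm hσ)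
    have h1 := coeff_pderiv (i := k) f (σ - Finsupp.single k 1)
    rw [h, coeff_zero, tsub_add_cancel_of_le
      (Finsupp.single_le_iff.mpr (Nat.one_le_iff_ne_zero.mpr hk))] at h1
    exact (mul_eq_zero.mp h1.symm).resolve_right (Nat.cast_add_one_ne_zero _)

/-- Schur's lemma for the Fock space: commuting with multiplications makes `Z` multiplication by `Z
1`, and commuting with the derivatives makes `Z 1` constant. -/
theorem eq_smul_one_of_lie_osc {Z : Module.End ℂ Space} (h : ∀ n, ⁅Z, osc n⁆ = 0) :
    Z = constantCoeff (Z 1) • 1 := by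
  have hX (k : ℕ) (f : Space) : Z (X k * f) = X k * Z f := by
    have := LinearMap.congr_fun (h (-(k + 1))) f
    rw [osc_neg, Ring.lie_def] at this
    exact sub_eq_zero.mp this
  have hd (k : ℕ) : pderiv k (Z 1) = 0 := by
    have h1 := LinearMap.congr_fun (h (k + 1)) 1
    rw [osc_pos, commutator_smul_right, Ring.lie_def, LinearMap.smul_apply, LinearMap.zero_apply] at h1
    have h2 := (smul_eq_zero.mp h1).resolve_left (Nat.cast_add_one_ne_zero _)
    simpa using h2
  have h1 : Z 1 = C (constantCoeff (Z 1)) := eq_C_of_pderiv_eq_zero hd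
  refine LinearMap.ext fun f => ?_
  induction f using MvPolynomial.induction_on with
  | C a =>
    rw [← mul_one (C a), ← smul_eq_C_mul, map_smul, map_smul, h1]
    simp [smul_eq_C_mul]
  | add p q hp hq => rw [map_add, map_add, hp, hq]
  | mul_X p k hp =>
    rw [mul_comm, hX, hp]
    simp

theorem vir_one_of_nonneg {m : ℤ} (hm : 0 ≤ m) : vir m 1 = 0 := by
  have : quad m 1 = 0 := by
    rw [quad, LinearMap.smul_apply, LinearMap.sum_apply, Finset.sum_eq_zero, smul_zero]
    intro i hi
    rw [Finset.mem_Ioo] at hi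
    rw [Module.End.mul_apply, osc_one_of_nonneg (by lia), map_zero]
  simp [vir, this]

theorem vir_one_of_neg {n : ℤ} (hn : n < 0) :
    vir n 1 = (1 / 2 : ℂ) • ∑ i ∈ Finset.Ioo n 0, osc i (osc (n - i) 1) := by
  simp [vir, quad, min_eq_right hn.le, max_eq_left hn.le]

theorem constantCoeff_vir_one (m : ℤ) : constantCoeff (vir m 1) = 0 := by
  rcases le_or_gt 0 m with hm | hm
  · rw [vir_one_of_nonneg hm, map_zero]
  · rw [vir_one_of_neg hm, constantCoeff_smul, map_sum, Finset.sum_eq_zero, smul_zero]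
    intro i hi
    exact constantCoeff_osc (Finset.mem_Ioo.mp hi).2 _

theorem sum_Ioo_mul (c : ℂ) (m : ℕ) : ∑ i ∈ Finset.Ioo (-((m : ℤ) + 1)) 0, -(i : ℂ) * (c + i) =
    c * (m * (m + 1) / 2) - m * (m + 1) * (2 * m + 1) / 6 := by
  induction m with
  | zero =>
    rw [show Finset.Ioo (-(((0 : ℕ) : ℤ) + 1)) 0 = ∅ by decide]
    simp
  | succ m ih =>
    have : Finset.Ioo (-(((m + 1 : ℕ) : ℤ) + 1)) 0 =
        insert (-((m : ℤ) + 1)) (Finset.Ioo (-((m : ℤ) + 1)) 0) := by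
      ext i
      simp only [Finset.mem_Ioo, Finset.mem_insert]
      lia
    rw [this, Finset.sum_insert (by simp), ih]
    push_cast
    ring

/-- The vacuum expectation value that fixes the central charge. Moving `vir m` past the creation
operator `osc i` leaves only `-i • osc (m + i) (osc (n - i) 1)`, whose constant term comes from the
oscillator commutator; `sum_Ioo_mul` evaluates the sum. -/
theorem constantCoeff_vir_vir_one (m n : ℤ) : constantCoeff (vir m (vir n 1)) =
    if m + n = 0 ∧ 0 ≤ m then ((m : ℂ) ^ 3 - m) / 12 else 0 := by
  rcases le_or_gt 0 n with hn | hn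
  · rw [vir_one_of_nonneg hn, map_zero, map_zero]
    split_ifs with h
    · rw [show m = 0 by lia]
      simp
    · rfl
  have comm (k j : ℤ) (f : Space) : vir k (osc j f) = osc j (vir k f) - (j : ℂ) • osc (k + j) f := by
    have := LinearMap.congr_fun (vir_lie_osc k j) f
    rw [Ring.lie_def] at this
    simp only [LinearMap.sub_apply, Module.End.mul_apply, LinearMap.smul_apply] at this
    linear_combination (norm := module) this
  have term (i : ℤ) (hi : i ∈ Finset.Ioo n 0) : constantCoeff (vir m (osc i (osc (n - i) 1))) =
      if m + n = 0 then -(i : ℂ) * (m + i) else 0 := by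
    rw [Finset.mem_Ioo] at hi
    have h1 := congrArg constantCoeff (LinearMap.congr_fun (osc_lie (m + i) (n - i)) 1)
    rw [Ring.lie_def, LinearMap.sub_apply, Module.End.mul_apply, Module.End.mul_apply, map_sub,
      constantCoeff_osc (j := n - i) (by lia), sub_zero, show m + i + (n - i) = m + n by ring] at h1
    rw [comm, map_sub, constantCoeff_osc hi.2, constantCoeff_smul, h1, zero_sub]
    split_ifs
    · simp
    · simp
  rw [vir_one_of_neg hn, map_smul, map_sum, constantCoeff_smul, map_sum, Finset.sum_congr rfl term]
  by_cases h : m + n = 0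
  · rw [if_pos ⟨h, by lia⟩]
    simp only [if_pos h]
    obtain ⟨k, rfl⟩ : ∃ k : ℕ, n = -(k + 1) := ⟨(-n - 1).toNat, by lia⟩
    rw [sum_Ioo_mul, show m = k + 1 by lia]
    simp only [smul_eq_mul]
    push_cast
    ring
  · rw [if_neg (by lia)]
    simp only [if_neg h, Finset.sum_const_zero, smul_zero]

theorem vir_relations : Virasoro.Relations vir 1 where
  central m := by rw [Ring.lie_def, one_mul, mul_one, sub_self]
  lie_eq m n := by
    -- The defect commutes with every oscillator, so it is a scalar, read off on the vacuum.
    have h : ⁅vir m, vir n⁆ - ((m : ℂ) - n) • vir (m + n) =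
        constantCoeff ((⁅vir m, vir n⁆ - ((m : ℂ) - n) • vir (m + n)) 1) • 1 := by
      refine eq_smul_one_of_lie_osc fun k => ?_
      rw [sub_lie, lie_lie, vir_lie_osc, vir_lie_osc, commutator_smul_right, commutator_smul_right, commutator_smul_left, vir_lie_osc,
        vir_lie_osc, vir_lie_osc, show n + (m + k) = m + n + k by ring,
        show m + (n + k) = m + n + k by ring]
      push_cast
      module
    rw [← sub_eq_iff_eq_add', h]
    simp only [Ring.lie_def, LinearMap.sub_apply, Module.End.mul_apply, LinearMap.smul_apply,
      map_sub, constantCoeff_smul, constantCoeff_vir_one, constantCoeff_vir_vir_one]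
    by_cases hmn : m + n = 0
    · obtain rfl : n = -m := by lia
      rcases lt_trichotomy m 0 with hm | rfl | hm
      · rw [if_neg (by lia), if_pos (by lia), if_pos hmn]
        push_cast
        congr 1
        simp only [smul_zero]
        ring
      · simp
      · rw [if_pos (by lia), if_neg (by lia), if_pos hmn]
        simp
    · rw [if_neg (by lia), if_neg (by lia), if_neg hmn]
      simp

theorem vir_mul_sub_mul (m n : ℤ) : vir m * vir n - vir n * vir m =
    ((m : ℂ) - n) • vir (m + n) + if m + n = 0 then (((m : ℂ) ^ 3 - m) / 12) • 1 else 0 :=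
  vir_relations.lie_eq m n

/-! ### Weights -/

/-- The weight of a monomial of the Fock space, in which `X_k` has weight `k + 1`. -/
def wt : (ℕ →₀ ℕ) →+ ℕ := Finsupp.weight fun k => k + 1

theorem wt_single (k e : ℕ) : wt (Finsupp.single k e) = e * (k + 1) := by
  simp [wt, Finsupp.weight_single]

theorem vir_zero_monomial (σ : ℕ →₀ ℕ) :
    vir 0 (monomial σ 1) = (wt σ : ℂ) • (monomial σ 1 : Space) := by
  have h0 : vir 0 = (shift 0).toLinearMap := by simp [vir, quad]
  rw [h0, Derivation.coeFn_coe]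
  induction σ using Finsupp.induction_linear with
  | zero => simp
  | add σ τ hσ hτ =>
    have h1 : (monomial (σ + τ) 1 : Space) = monomial σ 1 * monomial τ 1 := by
      rw [monomial_mul, one_mul]
    rw [h1, Derivation.leibniz, hσ, hτ, map_add, smul_eq_mul, smul_eq_mul, mul_smul_comm,
      mul_smul_comm, mul_comm (monomial τ 1)]
    push_cast
    module
  | single k e =>
    have hk : shift 0 (X k) = ((k : ℂ) + 1) • X k := by
      rw [shift_X, show (0 : ℤ) - k - 1 = -(k + 1) by ring, osc_neg_one]
    rw [← X_pow_eq_monomial, Derivation.leibniz_pow, hk, wt_single]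
    rcases e with _ | e
    · simp
    · rw [Nat.add_sub_cancel, smul_eq_mul, mul_smul_comm, ← pow_succ, ← Nat.cast_smul_eq_nsmul ℂ,
        smul_smul]
      push_cast
      rfl

theorem coeff_vir_zero (τ : ℕ →₀ ℕ) (f : Space) : coeff τ (vir 0 f) = wt τ * coeff τ f := by
  induction f using MvPolynomial.induction_on' with
  | monomial σ a =>
    have h1 : (monomial σ a : Space) = a • monomial σ 1 := by rw [smul_monomial, smul_eq_mul, mul_one]
    rw [h1, map_smul, vir_zero_monomial, coeff_smul, coeff_smul, coeff_smul, coeff_monomial]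
    split_ifs with h
    · rw [h]
      simp only [smul_eq_mul]
      ring
    · simp
  | add p q hp hq => rw [map_add, coeff_add, coeff_add, hp, hq, mul_add]

/-- `vir 0` is diagonal with the weights as eigenvalues, so `[L_0, L_m] = -m L_m` makes `vir m`
lower weight by `m`. -/
theorem wt_eq_of_coeff_vir_ne_zero {m : ℤ} {σ τ : ℕ →₀ ℕ}
    (h : coeff τ (vir m (monomial σ 1)) ≠ 0) : (wt τ : ℤ) + m = wt σ := by
  have h1 := congrArg (coeff τ) (LinearMap.congr_fun (vir_relations.lie_eq 0 m) (monomial σ 1))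
  have h2 : (if 0 + m = 0 then ((((0 : ℤ) : ℂ) ^ 3 - ((0 : ℤ) : ℂ)) / 12) • (1 : Module.End ℂ Space)
      else 0) = 0 := by
    split_ifs <;> simp
  rw [h2, add_zero, zero_add, Ring.lie_def, LinearMap.sub_apply, Module.End.mul_apply,
    Module.End.mul_apply, coeff_sub, coeff_vir_zero, vir_zero_monomial, map_smul, coeff_smul,
    LinearMap.smul_apply, coeff_smul, smul_eq_mul, smul_eq_mul, ← sub_mul] at h1
  have h3 := mul_right_cancel₀ h h1
  have h4 : ((wt τ : ℤ) + m : ℂ) = (wt σ : ℤ) := by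
    push_cast at h3 ⊢
    linear_combination h3
  exact_mod_cast h4

end Fock

/-! ### Subexponential growth of the Fock space -/

/-- Otherwise `s` grows by a factor of at least `k / (k - 1)` over every step of length `k`, which
is exponential growth and contradicts boundedness of `s N * x ^ N` for `x` near 1. -/
theorem exists_small_growth {s : ℕ → ℕ} (hs : ∀ N, 1 ≤ s N)
    (h : ∀ x : ℝ, 0 < x → x < 1 → ∃ C : ℝ, ∀ N, s N * x ^ N ≤ C) (k : ℕ) :
    ∃ N, k ≤ N ∧ k * s (N + k) ≤ s (N + k) + k * s N := by
  by_contra! hcon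
  have hk : 2 ≤ k := by
    by_contra! hk
    have := hcon k le_rfl
    interval_cases k <;> omega
  have hk0 : (0 : ℝ) < k := by positivity
  have hk1 : (0 : ℝ) < k - 1 := by
    have : (2 : ℝ) ≤ k := by exact_mod_cast hk
    linarith
  have hr (N : ℕ) (hN : k ≤ N) : (k / (k - 1) : ℝ) * s N ≤ s (N + k) := by
    have h1 : (s (N + k) + k * s N : ℝ) ≤ k * s (N + k) := by exact_mod_cast (hcon N hN).le
    rw [div_mul_eq_mul_div, div_le_iff₀ hk1]
    linarith
  have hpow (j : ℕ) : (k / (k - 1) : ℝ) ^ j ≤ s (k + j * k) := by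
    induction j with
    | zero => simpa using hs k
    | succ j ih =>
      calc (k / (k - 1) : ℝ) ^ (j + 1) = (k / (k - 1)) * (k / (k - 1)) ^ j := pow_succ' _ _
        _ ≤ (k / (k - 1)) * s (k + j * k) := by gcongr
        _ ≤ s (k + j * k + k) := hr _ (Nat.le_add_right _ _)
        _ = s (k + (j + 1) * k) := by congr 2; ring
  -- By Bernoulli `(1 - d) ^ k ≥ 1 - 1 / (2 * k) > (k - 1) / k`, so `x = 1 - d` still loses to the
  -- growth factor.
  let d : ℝ := 1 / (2 * k ^ 2)
  have hd0 : 0 < d := by positivity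
  have hd1 : d < 1 := by
    rw [div_lt_one (by positivity)]
    nlinarith
  have hx : (1 : ℝ) < k / (k - 1) * (1 - d) ^ k := by
    have h1 : (1 : ℝ) + k * (-d) ≤ (1 + (-d)) ^ k := one_add_mul_le_pow (by linarith) k
    have h2 : (k : ℝ) * d = 1 / (2 * k) := by
      simp only [d]
      field_simp
    have h3 : ((k : ℝ) - 1) / k < 1 - 1 / (2 * k) := by
      rw [div_lt_iff₀ hk0]
      field_simp
      linarith
    have h4 : ((k : ℝ) - 1) / k < (1 - d) ^ k := by
      rw [← sub_eq_add_neg] at h1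
      linarith
    calc (1 : ℝ) = k / (k - 1) * ((k - 1) / k) := by field_simp
      _ < _ := by gcongr
  obtain ⟨C, hC⟩ := h (1 - d) (by linarith) (by linarith)
  have hxk : 0 < (1 - d) ^ k := pow_pos (by linarith) k
  obtain ⟨j, hj⟩ := pow_unbounded_of_one_lt (C / (1 - d) ^ k) hx
  rw [div_lt_iff₀ hxk] at hj
  refine (hj.trans_le ?_).not_ge (hC (k + j * k))
  calc (k / (k - 1) * (1 - d) ^ k) ^ j * (1 - d) ^ k
      = (k / (k - 1)) ^ j * (1 - d) ^ (k + j * k) := by rw [mul_pow, pow_add, mul_comm j, pow_mul]; ring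
    _ ≤ s (k + j * k) * (1 - d) ^ (k + j * k) :=
      mul_le_mul_of_nonneg_right (hpow j) (pow_nonneg (by linarith) _)

/-! ### Counting monomials by weight -/

namespace Fock

open Finset

/-- The set of all monomials of weight at most `N`. -/
def ball (N : ℕ) : Finset (ℕ →₀ ℕ) :=
  ((range N).finsupp fun _ => range (N + 1)).filter fun σ => wt σ ≤ N

theorem mem_ball {N : ℕ} {σ : ℕ →₀ ℕ} : σ ∈ ball N ↔ wt σ ≤ N := by
  rw [ball, mem_filter, and_iff_right_iff_imp]
  intro h
  rw [mem_finsupp_iff]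
  refine ⟨fun k hk => ?_, fun k _ => ?_⟩
  · have := Finsupp.le_weight_of_ne_zero' (fun k : ℕ => k + 1) (Finsupp.mem_support_iff.mp hk)
    rw [mem_range]
    exact this.trans h
  · have := Finsupp.le_weight (fun k : ℕ => k + 1) (Nat.succ_ne_zero k) σ
    rw [mem_range]
    exact Nat.lt_succ_of_le (this.trans h)

theorem ball_mono {M N : ℕ} (h : M ≤ N) : ball M ⊆ ball N := fun _ hσ =>
  mem_ball.mpr ((mem_ball.mp hσ).trans h)

theorem lt_card_ball (N : ℕ) : N < (ball N).card := by
  have : ((range (N + 1)).image fun e => Finsupp.single 0 e) ⊆ ball N := by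
    intro σ hσ
    obtain ⟨e, he, rfl⟩ := mem_image.mp hσ
    rw [mem_ball, wt_single, zero_add, mul_one]
    exact Nat.le_of_lt_succ (mem_range.mp he)
  calc N < (range (N + 1)).card := by simp
    _ = ((range (N + 1)).image fun e => Finsupp.single 0 e).card :=
      (card_image_of_injective _ (Finsupp.single_injective 0)).symm
    _ ≤ _ := card_le_card this

theorem sum_pow_wt (x : ℝ) (s t : Finset ℕ) : ∑ σ ∈ s.finsupp fun _ => t, x ^ wt σ =
    ∏ k ∈ s, ∑ e ∈ t, (x ^ (k + 1)) ^ e := by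
  rw [prod_sum, Finset.finsupp, sum_map]
  refine sum_congr (by congr!) fun p _ => ?_
  have : wt (Finsupp.indicator s p) = ∑ k ∈ s, Finsupp.indicator s p k * (k + 1) := by
    rw [wt, Finsupp.weight_apply, Finsupp.sum_of_support_subset _ (Finsupp.support_indicator_subset _ _)]
    · simp only [smul_eq_mul]
    · simp
  rw [Function.Embedding.coeFn_mk, this, ← prod_pow_eq_pow_sum, ← prod_attach]
  refine prod_congr rfl fun k _ => ?_
  rw [Finsupp.indicator_of_mem k.2, ← pow_mul, mul_comm]

theorem geom_sum_le_exp {x y : ℝ} (hx : x < 1) (hy : 0 ≤ y) (hyx : y ≤ x) (N : ℕ) :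
    ∑ e ∈ range N, y ^ e ≤ Real.exp (y / (1 - x)) := by
  have hy1 : y < 1 := hyx.trans_lt hx
  have h0 : 0 < 1 - y := by linarith
  have h1 : 0 < 1 - x := by linarith
  calc ∑ e ∈ range N, y ^ e ≤ ∑' e, y ^ e :=
        (summable_geometric_of_lt_one hy hy1).sum_le_tsum _ fun _ _ => pow_nonneg hy _
    _ = y / (1 - y) + 1 := by rw [tsum_geometric_of_lt_one hy hy1]; field_simp; ring
    _ ≤ y / (1 - x) + 1 := by gcongr
    _ ≤ Real.exp (y / (1 - x)) := Real.add_one_le_exp _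

/-- Bound the count by the truncated partition generating function, which factors as an Euler
product. Each factor is at most `exp (x ^ (k + 1) / (1 - x))`, and the exponents are summable. -/
theorem card_ball_mul_pow_le {x : ℝ} (hx0 : 0 < x) (hx1 : x < 1) (N : ℕ) :
    (ball N).card * x ^ N ≤ Real.exp ((1 - x)⁻¹ / (1 - x)) := by
  have h1 : 0 < 1 - x := by linarith
  have hk (k : ℕ) : x ^ (k + 1) ≤ x := pow_le_of_le_one hx0.le hx1.le (Nat.succ_ne_zero k)
  calc ((ball N).card : ℝ) * x ^ N = ∑ σ ∈ ball N, x ^ N := by rw [sum_const, nsmul_eq_mul]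
    _ ≤ ∑ σ ∈ ball N, x ^ wt σ :=
      sum_le_sum fun σ hσ => pow_le_pow_of_le_one hx0.le hx1.le (mem_ball.mp hσ)
    _ ≤ ∑ σ ∈ (range N).finsupp fun _ => range (N + 1), x ^ wt σ :=
      sum_le_sum_of_subset_of_nonneg (filter_subset _ _) fun _ _ _ => pow_nonneg hx0.le _
    _ = ∏ k ∈ range N, ∑ e ∈ range (N + 1), (x ^ (k + 1)) ^ e := sum_pow_wt _ _ _
    _ ≤ ∏ k ∈ range N, Real.exp (x ^ (k + 1) / (1 - x)) :=
      prod_le_prod (fun _ _ => sum_nonneg fun _ _ => by positivity) fun k _ =>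
        geom_sum_le_exp hx1 (by positivity) (hk k) _
    _ = Real.exp ((∑ k ∈ range N, x ^ (k + 1)) / (1 - x)) := by rw [← Real.exp_sum, sum_div]
    _ ≤ Real.exp ((1 - x)⁻¹ / (1 - x)) := by
      gcongr
      rw [← tsum_geometric_of_lt_one hx0.le hx1]
      refine (sum_le_sum fun k _ => ?_).trans
        ((summable_geometric_of_lt_one hx0.le hx1).sum_le_tsum (range N)
          fun _ _ => pow_nonneg hx0.le _)
      exact pow_le_pow_of_le_one hx0.le hx1.le (Nat.le_succ k)

theorem exists_card_ball_growth (k : ℕ) : ∃ N, k ≤ N ∧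
    k * (ball (N + k)).card ≤ (ball (N + k)).card + k * (ball N).card :=
  exists_small_growth (s := fun N => (ball N).card)
    (fun N => (Nat.succ_le_succ N.zero_le).trans (lt_card_ball N))
    (fun _ hx0 hx1 => ⟨_, card_ball_mul_pow_le hx0 hx1⟩) k

end Fock

/-! ### Ideals of the Virasoro algebra -/

namespace Virasoro

open LaurentPolynomial LieAlgebra

theorem lie_mk_T (i j : ℤ) : ⁅mk (T i) 0, mk (T j) 0⁆ =
    mk (((j : ℂ) - i) • T (i + j - 1))
      (if i + j = 2 then (((i : ℂ) - 1) ^ 3 - ((i : ℂ) - 1)) / 12 else 0) := by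
  refine vir_ext ?_ ?_
  · rw [symbol_lie, symbol_mk, symbol_mk, symbol_mk, ddt_T, ddt_T, mul_smul_comm, mul_smul_comm,
      ← T_add, ← T_add, show i + (j - 1) = i + j - 1 by ring,
      show j + (i - 1) = i + j - 1 by ring, sub_smul]
  · rw [centralCoord_lie, symbol_mk, symbol_mk, centralCoord_mk, form_T]

theorem mk_smul_zero (a : ℂ) (f : ℂ[T;T⁻¹]) : mk (a • f) 0 = a • mk f 0 :=
  vir_ext (by simp) (by simp)

/-- One monomial generates enough others: the brackets for `(T 0, T 2)` and `(T (-1), T 3)` have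
proportional symbols, but only the second has a central term. -/
theorem central_mem_of_symbol_eq (I : LieIdeal ℂ VirasoroAlgebra) {v : VirasoroAlgebra} (hv : v ∈ I)
    {a : ℂ} (ha : a ≠ 0) {i : ℤ} (hi : symbol v = a • T i) : mk 0 1 ∈ I := by
  have step (i j : ℤ) (h : mk (T i) 0 ∈ I) (hij : i + j ≠ 2) (hne : i ≠ j) :
      mk (T (i + j - 1)) 0 ∈ I := by
    have h1 : ⁅mk (T j) 0, mk (T i) 0⁆ ∈ I := LieSubmodule.lie_mem I h
    rw [lie_mk_T, if_neg (by lia), mk_smul_zero, add_comm] at h1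
    exact (I.toSubmodule.smul_mem_iff (sub_ne_zero.mpr (by exact_mod_cast hne))).mp h1
  -- Degree 4 is a safe target: the coefficient `2 * i - 5` is odd, hence nonzero, and total degree
  -- 5 makes the cocycle vanish. The bracket also removes the central part of `v`.
  have h4 : mk (T 4) 0 ∈ I := by
    have h1 : ⁅mk (T (5 - i)) 0, v⁆ ∈ I := LieSubmodule.lie_mem I hv
    have h2 : ⁅mk (T (5 - i)) 0, v⁆ = (a * (2 * i - 5)) • mk (T 4) 0 := by
      refine vir_ext ?_ ?_
      · rw [symbol_lie, map_smul, symbol_mk, symbol_mk, hi, Derivation.map_smul, ddt_T, ddt_T]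
        simp only [mul_smul_comm, smul_mul_assoc, ← T_add]
        rw [show 5 - i + (i - 1) = 4 by ring, show i + (5 - i - 1) = 4 by ring]
        push_cast
        module
      · rw [centralCoord_lie, map_smul, symbol_mk, centralCoord_mk, hi, map_smul, form_T,
          if_neg (by lia), smul_zero, smul_zero]
    rw [h2] at h1
    refine (I.toSubmodule.smul_mem_iff (mul_ne_zero ha ?_)).mp h1
    have : (2 * i - 5 : ℤ) ≠ 0 := by lia
    exact_mod_cast this
  have h3 : mk (T 3) 0 ∈ I := step 4 0 h4 (by norm_num) (by norm_num)
  have h2 : mk (T 2) 0 ∈ I := step 3 0 h3 (by norm_num) (by norm_num)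
  have h1 : ⁅mk (T 0) 0, mk (T 2) 0⁆ ∈ I := LieSubmodule.lie_mem I h2
  have h0 : ⁅mk (T (-1)) 0, mk (T 3) 0⁆ ∈ I := LieSubmodule.lie_mem I h3
  have : (mk 0 1 : VirasoroAlgebra) =
      (2 : ℂ) • ((2 : ℂ) • ⁅mk (T 0) 0, mk (T 2) 0⁆ - ⁅mk (T (-1)) 0, mk (T 3) 0⁆) := by
    rw [lie_mk_T, lie_mk_T]
    refine vir_ext ?_ ?_
    · simp only [map_smul, map_sub, symbol_mk]
      norm_num
      module
    · simp only [map_smul, map_sub, centralCoord_mk]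
      norm_num
  rw [this]
  exact I.toSubmodule.smul_mem _ (I.toSubmodule.sub_mem (I.toSubmodule.smul_mem _ h1) h0)

theorem coeff_T_one_mul_ddt (f : ℂ[T;T⁻¹]) (i : ℤ) :
    (T 1 * ddt f).coeff i = i * f.coeff i := by
  induction f using LaurentPolynomial.induction_on' with
  | add p q hp hq =>
    simp only [map_add, mul_add, AddMonoidAlgebra.coeff_add, Finsupp.add_apply, hp, hq]
  | C_mul_T n a =>
    rw [← smul_eq_C_mul, Derivation.map_smul, ddt_T, mul_smul_comm, mul_smul_comm, ← T_add,
      show 1 + (n - 1) = n by ring]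
    simp only [AddMonoidAlgebra.coeff_smul, Finsupp.smul_apply, smul_eq_mul, T_apply]
    split_ifs with h
    · rw [h]
      ring
    · ring

theorem central_mem_of_ne_zero (I : LieIdeal ℂ VirasoroAlgebra) {v : VirasoroAlgebra} (hv : v ∈ I)
    (hv0 : v ≠ 0) : mk 0 1 ∈ I := by
  by_cases hs : symbol v = 0
  · have hc : centralCoord v ≠ 0 := fun h => hv0 (vir_ext (by simpa using hs) (by simpa using h))
    have : v = centralCoord v • mk 0 1 := vir_ext (by simp [hs]) (by simp)
    rw [this] at hv
    exact (I.toSubmodule.smul_mem_iff hc).mp hv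
  clear hv0
  induction hn : (symbol v).coeff.support.card using Nat.strong_induction_on generalizing v with
  | _ n ih =>
    have hne : (symbol v).coeff ≠ 0 := fun h => hs (LaurentPolynomial.ext fun i => by rw [h]; rfl)
    obtain ⟨i, hi⟩ := Finsupp.support_nonempty_iff.mpr hne
    -- `ad x_0` is diagonal on monomials; subtracting its eigenvalue at `T i` removes exactly that
    -- monomial from the symbol.
    let u : VirasoroAlgebra := (1 - (i : ℂ)) • v - ⁅mk (-T 1) 0, v⁆
    have hu : u ∈ I := I.toSubmodule.sub_mem (I.toSubmodule.smul_mem _ hv) (LieSubmodule.lie_mem I hv)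
    have hcoeff (j : ℤ) : (symbol u).coeff j = ((j : ℂ) - i) * (symbol v).coeff j := by
      have h1 : symbol u = (T 1 * ddt (symbol v)) - (i : ℂ) • symbol v := by
        simp only [u, map_sub, map_smul, symbol_lie, symbol_mk, map_neg, ddt_T]
        rw [sub_self, T_zero, Int.cast_one, one_smul]
        simp only [sub_smul, one_smul]
        ring
      rw [h1, AddMonoidAlgebra.coeff_sub, Finsupp.sub_apply, coeff_T_one_mul_ddt,
        AddMonoidAlgebra.coeff_smul, Finsupp.smul_apply, smul_eq_mul]
      ring
    have hsupp : (symbol u).coeff.support = (symbol v).coeff.support.erase i := by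
      ext j
      rw [Finsupp.mem_support_iff, hcoeff, Finset.mem_erase, Finsupp.mem_support_iff,
        mul_ne_zero_iff, sub_ne_zero, Ne, Int.cast_inj]
    by_cases hu0 : symbol u = 0
    · refine central_mem_of_symbol_eq I hv (Finsupp.mem_support_iff.mp hi) (i := i) ?_
      refine LaurentPolynomial.ext fun j => ?_
      rw [AddMonoidAlgebra.coeff_smul, Finsupp.smul_apply, T_apply, smul_eq_mul]
      split_ifs with hij
      · rw [hij, mul_one]
      · have := hcoeff j
        rw [hu0] at this
        rw [mul_zero]
        exact (mul_eq_zero.mp this.symm).resolve_left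
          (sub_ne_zero.mpr (by exact_mod_cast Ne.symm hij))
    · refine ih _ ?_ hu hu0 rfl
      rw [hsupp, ← hn]
      exact Finset.card_erase_lt_of_mem hi

end Virasoro

/-! ### Soficity -/

theorem rank_le_card_of_col_eq_zero {K : Type*} [Field K] {n : ℕ} (A : Matrix (Fin n) (Fin n) K)
    (t : Finset (Fin n)) (h : ∀ j ∉ t, ∀ i, A i j = 0) : A.rank ≤ t.card := by
  classical
  rw [Matrix.rank_eq_finrank_span_cols]
  have hle : Submodule.span K (Set.range A.col) ≤ Submodule.span K (t.image A.col : Set (Fin n → K)) := by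
    rw [Submodule.span_le]
    rintro _ ⟨j, rfl⟩
    by_cases hj : j ∈ t
    · exact Submodule.subset_span (Finset.mem_coe.mpr (Finset.mem_image_of_mem _ hj))
    · have : A.col j = 0 := funext fun i => h j hj i
      rw [this]
      exact zero_mem _
  exact (Submodule.finrank_mono hle).trans
    ((finrank_span_finset_le_card _).trans Finset.card_image_le)

/-! ### Compressions to weight balls -/

namespace Fock

open MvPolynomial

/-- The compression of an operator on the Fock space to the span of finitely many monomials. -/
def compress (S : Finset (ℕ →₀ ℕ)) :
    Module.End ℂ Space →ₗ[ℂ] Matrix (Fin S.card) (Fin S.card) ℂ where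
  toFun A := Matrix.of fun i j =>
    coeff (S.equivFin.symm i) (A (monomial (S.equivFin.symm j : ℕ →₀ ℕ) 1))
  map_add' A B := by
    ext i j
    simp
  map_smul' c A := by
    ext i j
    simp

theorem compress_apply (S : Finset (ℕ →₀ ℕ)) (A : Module.End ℂ Space) (i j : Fin S.card) :
    compress S A i j =
      coeff (S.equivFin.symm i) (A (monomial (S.equivFin.symm j : ℕ →₀ ℕ) 1)) := rfl

theorem compress_one (S : Finset (ℕ →₀ ℕ)) : compress S 1 = 1 := by
  ext i j
  rw [compress_apply, Module.End.one_apply, coeff_monomial, Matrix.one_apply]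
  by_cases h : i = j
  · simp [h]
  · rw [if_neg h, if_neg]
    intro h'
    exact h (S.equivFin.symm.injective (Subtype.ext h')).symm

theorem compress_mul_apply {S : Finset (ℕ →₀ ℕ)} (A B : Module.End ℂ Space) (i j : Fin S.card)
    (hB : ∀ τ, coeff τ (B (monomial (S.equivFin.symm j : ℕ →₀ ℕ) 1)) ≠ 0 → τ ∈ S) :
    (compress S A * compress S B) i j = compress S (A * B) i j := by
  set f := B (monomial (S.equivFin.symm j : ℕ →₀ ℕ) 1) with hf
  have h1 : f = ∑ τ ∈ S, coeff τ f • (monomial τ 1 : Space) := by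
    ext ρ
    simp only [coeff_sum, coeff_smul, coeff_monomial, smul_eq_mul, mul_ite, mul_one, mul_zero,
      Finset.sum_ite_eq']
    split_ifs with hρ
    · rfl
    · by_contra h
      exact hρ (hB ρ h)
  rw [compress_apply, Module.End.mul_apply, ← hf, h1, Matrix.mul_apply, map_sum, coeff_sum,
    ← Finset.sum_coe_sort S, ← S.equivFin.symm.sum_comp]
  refine Finset.sum_congr rfl fun k _ => ?_
  rw [map_smul, coeff_smul, smul_eq_mul, compress_apply, compress_apply, mul_comm]

/-- The defect vanishes on every column indexed by `G`, since there `B` stays in the span of `S` and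
truncating between `B` and `A` loses nothing. -/
theorem rank_compress_sub_le {S G : Finset (ℕ →₀ ℕ)} (hGS : G ⊆ S) (A B : Module.End ℂ Space)
    (hB : ∀ σ ∈ G, ∀ τ, coeff τ (B (monomial σ 1)) ≠ 0 → τ ∈ S) :
    (compress S A * compress S B - compress S (A * B)).rank ≤ S.card - G.card := by
  classical
  have h1 := rank_le_card_of_col_eq_zero (compress S A * compress S B - compress S (A * B))
    (Finset.univ.filter fun j => (S.equivFin.symm j : ℕ →₀ ℕ) ∉ G) (by
      intro j hj i
      rw [Finset.mem_filter, not_and, not_not] at hj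
      rw [Matrix.sub_apply, compress_mul_apply A B i j (hB _ (hj (Finset.mem_univ _))), sub_self])
  refine h1.trans ?_
  rw [← Finset.card_sdiff_of_subset hGS]
  refine Finset.card_le_card_of_injOn (fun j => (S.equivFin.symm j : ℕ →₀ ℕ)) ?_ ?_
  · intro j hj
    rw [Finset.mem_coe, Finset.mem_filter] at hj
    exact Finset.mem_coe.mpr (Finset.mem_sdiff.mpr ⟨(S.equivFin.symm j).2, hj.2⟩)
  · intro i _ j _ h
    exact S.equivFin.symm.injective (Subtype.ext h)

theorem compress_vir_mul_sub_mem (N : ℕ → ℕ)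
    (hN : ∀ k, k * (ball (N k + k)).card ≤ (ball (N k + k)).card + k * (ball (N k)).card)
    (ω : Ultrafilter ℕ) (hω : (ω : Filter ℕ) ≤ atTop) (A : Module.End ℂ Space) (n : ℤ) :
    (fun k => compress (ball (N k + k)) A * compress (ball (N k + k)) (vir n) -
      compress (ball (N k + k)) (A * vir n)) ∈
      Sofic.rankKernel ℂ ω fun k => (ball (N k + k)).card := by
  change Tendsto _ (ω : Filter ℕ) (𝓝 0)
  refine Tendsto.mono_left ?_ hω
  refine squeeze_zero' (Eventually.of_forall fun k => Sofic.normalizedRank_nonneg _) ?_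
    (tendsto_one_div_atTop_nhds_zero_nat (𝕜 := ℝ))
  -- Once `k ≥ |n|`, `vir n` maps weight at most `N k` into weight at most `N k + k`; the extra 1
  -- makes `k` positive.
  filter_upwards [eventually_ge_atTop (n.natAbs + 1)] with k hk
  have hr := rank_compress_sub_le (ball_mono (Nat.le_add_right (N k) k)) A (vir n) (by
    intro σ hσ τ hτ
    rw [mem_ball] at hσ ⊢
    have := wt_eq_of_coeff_vir_ne_zero hτ
    lia)
  have hc : (ball (N k)).card ≤ (ball (N k + k)).card :=
    Finset.card_le_card (ball_mono (Nat.le_add_right _ _))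
  have hpos : 0 < (ball (N k + k)).card := (Nat.zero_le _).trans_lt (lt_card_ball _)
  have hk0 : (0 : ℝ) < k := by exact_mod_cast (by lia : 0 < k)
  rw [Sofic.normalizedRank, div_le_div_iff₀ (by exact_mod_cast hpos) hk0, one_mul]
  have h2 : ((compress (ball (N k + k)) A * compress (ball (N k + k)) (vir n) -
      compress (ball (N k + k)) (A * vir n)).rank + (ball (N k)).card) ≤ (ball (N k + k)).card := by
    lia
  have h3 := hN k
  have h4 := Nat.mul_le_mul_left k h2
  rw [mul_add] at h4
  rw [mul_comm]
  exact_mod_cast (by lia : k * _ ≤ (ball (N k + k)).card)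

end Fock

namespace Virasoro

theorem isSofic : Sofic.IsSofic ℂ VirasoroAlgebra := by
  choose N hNk hN using Fock.exists_card_ball_growth
  let n : ℕ → ℕ := fun k => (Fock.ball (N k + k)).card
  let ω : Ultrafilter ℕ := hyperfilter ℕ
  have hω : (ω : Filter ℕ) ≤ atTop := Nat.hyperfilter_le_atTop
  let c (k : ℕ) := Fock.compress (Fock.ball (N k + k))
  let q := Ideal.Quotient.mkₐ ℂ (Sofic.rankKernel ℂ ω n)
  have hmul (A : Module.End ℂ Fock.Space) (j : ℤ) :
      q (fun k => c k A) * q (fun k => c k (Fock.vir j)) = q (fun k => c k (A * Fock.vir j)) := by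
    rw [← map_mul]
    exact Ideal.Quotient.eq.mpr (Fock.compress_vir_mul_sub_mem N hN ω hω A j)
  have hrel : Relations (M := Sofic.Ultraproduct ℂ ω n) (fun m => q fun k => c k (Fock.vir m)) 1 := by
    refine ⟨fun m => ?_, fun i j => ?_⟩
    · change 1 * q _ - q _ * 1 = 0
      rw [one_mul, mul_one, sub_self]
    · have h1 : (1 : Sofic.Ultraproduct ℂ ω n) = q (fun k => c k 1) := by
        rw [← map_one q]
        congr 1
        funext k
        exact (Fock.compress_one _).symm
      have h2 := Fock.vir_mul_sub_mul i j
      change q _ * q _ - q _ * q _ = _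
      rw [hmul, hmul, ← map_sub, h1, ← map_smul]
      have h3 : (if i + j = 0 then (((i : ℂ) ^ 3 - i) / 12) • q (fun k => c k 1) else 0) =
          q (fun k => c k (if i + j = 0 then (((i : ℂ) ^ 3 - i) / 12) • 1 else 0)) := by
        split_ifs
        · rw [← map_smul]
          congr 1
        · rw [← map_zero q]
          congr 1
      rw [h3, ← map_add]
      congr 1
      funext k
      have h4 := congrArg (c k) h2
      rw [map_sub, map_add, map_smul] at h4
      exact h4
  have hn (k : ℕ) : k < n k := (Nat.le_add_left k (N k)).trans_lt (Fock.lt_card_ball _)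
  refine ⟨ω, n, fun k hk => ?_, tendsto_atTop_mono (fun k => (hn k).le) tendsto_id, liftHom hrel, ?_⟩
  · have h1 : ({k} : Set ℕ) ∈ (ω : Filter ℕ) := by
      rw [hk]
      exact Set.mem_singleton k
    exact notMem_hyperfilter_of_finite (Set.finite_singleton k) h1
  · rw [injective_iff_map_eq_zero]
    intro v hv
    by_contra hv0
    -- A nonzero kernel would contain `c`, which maps to `1`; but identity matrices have normalized
    -- rank 1.
    have h1 : mk 0 1 ∈ (liftHom hrel).ker := central_mem_of_ne_zero _ (LieHom.mem_ker.mpr hv) hv0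
    rw [LieHom.mem_ker, liftHom_apply, symbol_mk, map_zero, zero_add, centralCoord_mk, one_smul] at h1
    have h2 : (1 : (k : ℕ) → Matrix (Fin (n k)) (Fin (n k)) ℂ) ∈ Sofic.rankKernel ℂ ω n :=
      Ideal.Quotient.eq_zero_iff_mem.mp h1
    have h3 : Tendsto (fun k => Sofic.normalizedRank (1 : Matrix (Fin (n k)) (Fin (n k)) ℂ))
      (ω : Filter ℕ) (𝓝 0) := h2
    have h4 (k : ℕ) : Sofic.normalizedRank (1 : Matrix (Fin (n k)) (Fin (n k)) ℂ) = 1 := by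
      rw [Sofic.normalizedRank, Matrix.rank_one, Fintype.card_fin, div_self]
      exact_mod_cast ((Nat.zero_le k).trans_lt (hn k)).ne'
    simp only [h4] at h3
    exact one_ne_zero (tendsto_nhds_unique tendsto_const_nhds h3)

end Virasoro

end

theorem mainTheorem7 :
    IsNontrivialCentralExtension Virasoro.proj ∧
      (∀ (L : Type*) [LieRing L] [LieAlgebra ℂ L] (p : L →ₗ⁅ℂ⁆ Witt),
        IsNontrivialCentralExtension p →
          ∃ e : L ≃ₗ⁅ℂ⁆ VirasoroAlgebra, ∀ x, Virasoro.proj (e x) = p x) ∧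
      Sofic.IsSofic ℂ VirasoroAlgebra :=
  ⟨Virasoro.isNontrivialCentralExtension_proj, fun _ _ _ _ hp => Virasoro.exists_equiv hp,
    Virasoro.isSofic⟩
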